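/- Let $k$ be an algebraically closed field of characteristic zero. For a Hopf algebra $H$ over $k$, let $P(H)=\{x\in H:\Delta(x)=x\otimes 1+1\otimes x\}$ be the Lie algebra of primitive elements (with the commutator bracket), let $U_H$ be the Hopf subalgebra of $H$ generated by $P(H)$, put $\delta(h)=\Delta(h)-(h\otimes 1+1\otimes h)$, let $\tau$ be the twist map of $H\otimes H$, and let $$P_2(H)=\{c\in H:\ \tau(\delta(c))=-\delta(c)\ \text{ and }\ \delta(c)\in P(H)\otimes P(H)\}.$$ The Hopf algebra $H$ is connected if its coradical is $k\cdot 1$; a connected Hopf algebra is locally finite if all terms of its coradical filtration are finite-dimensional, and it is primitively thick if its Gelfand–Kirillov dimension satisfies $\mathrm{GK.dim}(H)=\dim P(H)+1<\infty$. For a finite-dimensional Lie algebra $\mathfrak g$ over $k$, let $\mathcal A(\mathfrak g)$ be the class of locally finite connected Hopf algebras $H$ over $k$ with $P(H)\cong\mathfrak g$ as Lie algebras that are generated by $P_2(H)$ as Hopf algebras and satisfy $H\neq U_H$. **Lemma 3.3.** Let $\mathfrak g$ be a finite-dimensional solvable Lie algebra over $k$ (equivalently, since $k$ is algebraically closed of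 characteristic zero, a completely solvable one), and let $H\in\mathcal A(\mathfrak g)$. Then there exists a primitively thick Hopf subalgebra $A$ of $H$ such that $U_H\subseteq A$ and such that $A$ is isomorphic, as an algebra, to the universal enveloping algebra $U(\mathfrak h)$ of a Lie algebra $\mathfrak h$ over $k$ of dimension $\dim\mathfrak g+1$. -/

import Mathlib

open scoped TensorProduct

universe u v w

noncomputable section

namespace ConnHopf

/-! ### Coalgebras: subcoalgebras, the coradical and its filtration -/

section Coalgebra

variable (k : Type*) (C : Type*) [Field k] [AddCommGroup C] [Module k C] [Coalgebra k C]

variable {C} in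
/-- A subspace `D` with `Δ(D) ⊆ D ⊗ D`. -/
def IsSubcoalgebra (D : Submodule k C) : Prop :=
  ∀ d ∈ D, Coalgebra.comul (R := k) d ∈ LinearMap.range (TensorProduct.mapIncl D D)

variable {C} in
/-- A nonzero subcoalgebra without proper nonzero subcoalgebras. -/
def IsSimpleSubcoalgebra (D : Submodule k C) : Prop :=
  IsSubcoalgebra k D ∧ D ≠ ⊥ ∧ ∀ E : Submodule k C, IsSubcoalgebra k E → E ≤ D → E = ⊥ ∨ E = D

/-- The coradical `C₀`: the sum of all simple subcoalgebras. -/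
def coradical : Submodule k C :=
  sSup {D | IsSimpleSubcoalgebra k D}

/-- The coradical filtration: `C₀` is the coradical and
`C_{n+1} = Δ⁻¹(C ⊗ C_n + C₀ ⊗ C)`. -/
def coradicalFiltration : ℕ → Submodule k C
  | 0 => coradical k C
  | n + 1 =>
    (LinearMap.range (TensorProduct.mapIncl (⊤ : Submodule k C) (coradicalFiltration n)) ⊔
      LinearMap.range (TensorProduct.mapIncl (coradical k C) (⊤ : Submodule k C))).comap
      (Coalgebra.comul (R := k) (A := C))

end Coalgebra

/-! ### Gelfand-Kirillov dimension -/

/-- `GK.dim A = sup_V limsup_n log_n dim (V⁰ + V¹ + ⋯ + Vⁿ)`, where `V` runs over the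
finite-dimensional subspaces of `A`. -/
def gkDim (k A : Type*) [Field k] [Ring A] [Algebra k A] : EReal :=
  ⨆ (V : Submodule k A) (_ : V.FG),
    Filter.limsup
      (fun n : ℕ ↦
        ((Real.log (Module.finrank k ↥(⨆ i ≤ n, V ^ i)) / Real.log n : ℝ) : EReal))
      Filter.atTop

section Hopf

variable (k : Type*) (H : Type*) [Field k] [Ring H] [HopfAlgebra k H]

/-! ### Hopf subalgebras -/

/-- A Hopf subalgebra: a subalgebra `A` with `Δ(A) ⊆ A ⊗ A` and `S(A) ⊆ A`. -/
structure HopfSubalgebra extends Subalgebra k H where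
  comul_mem : ∀ a ∈ toSubalgebra, Coalgebra.comul (R := k) a ∈
    (Algebra.TensorProduct.map toSubalgebra.val toSubalgebra.val).range
  antipode_mem : ∀ a ∈ toSubalgebra, HopfAlgebra.antipode k a ∈ toSubalgebra

namespace HopfSubalgebra

variable {k H} (A : HopfSubalgebra k H)

/-- The inclusion `A ⊗ A → H ⊗ H`. -/
def tensorIncl : A.toSubalgebra ⊗[k] A.toSubalgebra →ₐ[k] H ⊗[k] H :=
  Algebra.TensorProduct.map A.toSubalgebra.val A.toSubalgebra.val

theorem tensorIncl_injective : Function.Injective A.tensorIncl :=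
  TensorProduct.map_injective_of_flat_flat A.toSubalgebra.val.toLinearMap
    A.toSubalgebra.val.toLinearMap Subtype.val_injective Subtype.val_injective

/-- The restriction of the comultiplication of `H` to `A`. -/
def comulHom : A.toSubalgebra →ₐ[k] A.toSubalgebra ⊗[k] A.toSubalgebra :=
  (AlgEquiv.ofInjective A.tensorIncl A.tensorIncl_injective).symm.toAlgHom.comp
    (((Bialgebra.comulAlgHom k H).comp A.toSubalgebra.val).codRestrict A.tensorIncl.range
      fun a ↦ A.comul_mem a a.2)

theorem tensorIncl_comulHom (a : A.toSubalgebra) :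
    A.tensorIncl (A.comulHom a) = Coalgebra.comul (R := k) (a : H) := by
  have := AlgEquiv.apply_symm_apply (AlgEquiv.ofInjective A.tensorIncl A.tensorIncl_injective)
    ((((Bialgebra.comulAlgHom k H).comp A.toSubalgebra.val).codRestrict A.tensorIncl.range
      fun a ↦ A.comul_mem a a.2) a)
  exact congrArg Subtype.val this

/-- The restriction of the counit of `H` to `A`. -/
def counitHom : A.toSubalgebra →ₐ[k] k :=
  (Bialgebra.counitAlgHom k H).comp A.toSubalgebra.val

/-- The restriction of the antipode of `H` to `A`. -/
def antipodeMap : A.toSubalgebra →ₗ[k] A.toSubalgebra :=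
  ((HopfAlgebra.antipode k (A := H)).comp A.toSubalgebra.val.toLinearMap).codRestrict
    (Subalgebra.toSubmodule A.toSubalgebra) fun a ↦ A.antipode_mem a a.2

theorem tensorIncl_comp_comulHom :
    A.tensorIncl.comp A.comulHom = (Bialgebra.comulAlgHom k H).comp A.toSubalgebra.val :=
  AlgHom.ext A.tensorIncl_comulHom

theorem val_injective : Function.Injective A.toSubalgebra.val := Subtype.val_injective

/-- A Hopf subalgebra is a bialgebra with the restricted structure maps. -/
instance instBialgebra : Bialgebra k A.toSubalgebra :=
  Bialgebra.ofAlgHom A.comulHom A.counitHom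
    (by
      have hinj : Function.Injective
          (Algebra.TensorProduct.map A.toSubalgebra.val A.tensorIncl) :=
        TensorProduct.map_injective_of_flat_flat A.toSubalgebra.val.toLinearMap
          A.tensorIncl.toLinearMap A.val_injective A.tensorIncl_injective
      have e1 : (Algebra.TensorProduct.map A.toSubalgebra.val A.tensorIncl).comp
          (Algebra.TensorProduct.assoc k k k A.toSubalgebra A.toSubalgebra
            A.toSubalgebra).toAlgHom =
          (Algebra.TensorProduct.assoc k k k H H H).toAlgHom.comp
            (Algebra.TensorProduct.map A.tensorIncl A.toSubalgebra.val) := by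
        apply AlgHom.toLinearMap_injective
        exact TensorProduct.ext_threefold fun _ _ _ ↦ rfl
      have e2 : (Algebra.TensorProduct.map A.tensorIncl A.toSubalgebra.val).comp
          (Algebra.TensorProduct.map A.comulHom (.id k A.toSubalgebra)) =
          (Algebra.TensorProduct.map (Bialgebra.comulAlgHom k H) (.id k H)).comp A.tensorIncl := by
        rw [tensorIncl, ← Algebra.TensorProduct.map_comp, ← Algebra.TensorProduct.map_comp]
        exact congrArg₂ _ A.tensorIncl_comp_comulHom rfl
      have e3 : (Algebra.TensorProduct.map A.toSubalgebra.val A.tensorIncl).comp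
          (Algebra.TensorProduct.map (.id k A.toSubalgebra) A.comulHom) =
          (Algebra.TensorProduct.map (.id k H) (Bialgebra.comulAlgHom k H)).comp A.tensorIncl := by
        rw [tensorIncl, ← Algebra.TensorProduct.map_comp, ← Algebra.TensorProduct.map_comp]
        exact congrArg₂ _ rfl A.tensorIncl_comp_comulHom
      ext a
      apply hinj
      have h1 := fun x ↦ DFunLike.congr_fun e1 x
      have h2 := fun x ↦ DFunLike.congr_fun e2 x
      have h3 := fun x ↦ DFunLike.congr_fun e3 x
      simp only [AlgHom.comp_apply] at h1 h2 h3 ⊢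
      rw [h1, h2, h3, A.tensorIncl_comulHom]
      exact Coalgebra.coassoc_apply (R := k) (a : H))
    (by
      have hinj : Function.Injective
          (Algebra.TensorProduct.map (.id k k) A.toSubalgebra.val) :=
        TensorProduct.map_injective_of_flat_flat LinearMap.id
          A.toSubalgebra.val.toLinearMap Function.injective_id A.val_injective
      have e : (Algebra.TensorProduct.map (.id k k) A.toSubalgebra.val).comp
          (Algebra.TensorProduct.map A.counitHom (.id k A.toSubalgebra)) =
          (Algebra.TensorProduct.map (Bialgebra.counitAlgHom k H) (.id k H)).comp A.tensorIncl := by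
        rw [tensorIncl, ← Algebra.TensorProduct.map_comp, ← Algebra.TensorProduct.map_comp]
        rfl
      ext a
      apply hinj
      have h := fun x ↦ DFunLike.congr_fun e x
      simp only [AlgHom.comp_apply] at h ⊢
      rw [h, A.tensorIncl_comulHom]
      exact Coalgebra.rTensor_counit_comul (R := k) (a : H))
    (by
      have hinj : Function.Injective
          (Algebra.TensorProduct.map A.toSubalgebra.val (.id k k)) :=
        TensorProduct.map_injective_of_flat_flat A.toSubalgebra.val.toLinearMap
          LinearMap.id A.val_injective Function.injective_id
      have e : (Algebra.TensorProduct.map A.toSubalgebra.val (.id k k)).comp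
          (Algebra.TensorProduct.map (.id k A.toSubalgebra) A.counitHom) =
          (Algebra.TensorProduct.map (.id k H) (Bialgebra.counitAlgHom k H)).comp A.tensorIncl := by
        rw [tensorIncl, ← Algebra.TensorProduct.map_comp, ← Algebra.TensorProduct.map_comp]
        rfl
      ext a
      apply hinj
      have h := fun x ↦ DFunLike.congr_fun e x
      simp only [AlgHom.comp_apply] at h ⊢
      rw [h, A.tensorIncl_comulHom]
      exact Coalgebra.lTensor_counit_comul (R := k) (a : H))

/-- A Hopf subalgebra is a Hopf algebra with the restricted structure maps. -/
instance instHopfAlgebra : HopfAlgebra k A.toSubalgebra where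
  antipode := A.antipodeMap
  mul_antipode_rTensor_comul := by
    have e : A.toSubalgebra.val.toLinearMap ∘ₗ LinearMap.mul' k A.toSubalgebra ∘ₗ
        A.antipodeMap.rTensor A.toSubalgebra =
        (LinearMap.mul' k H ∘ₗ (HopfAlgebra.antipode k).rTensor H) ∘ₗ
          A.tensorIncl.toLinearMap :=
      TensorProduct.ext' fun _ _ ↦ rfl
    refine LinearMap.ext fun a ↦ A.val_injective ?_
    have h := LinearMap.congr_fun e (A.comulHom a)
    refine h.trans ?_
    change LinearMap.mul' k H ((HopfAlgebra.antipode k).rTensor H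
      (A.tensorIncl (A.comulHom a))) = _
    rw [A.tensorIncl_comulHom]
    exact HopfAlgebra.mul_antipode_rTensor_comul_apply (R := k) (a : H)
  mul_antipode_lTensor_comul := by
    have e : A.toSubalgebra.val.toLinearMap ∘ₗ LinearMap.mul' k A.toSubalgebra ∘ₗ
        A.antipodeMap.lTensor A.toSubalgebra =
        (LinearMap.mul' k H ∘ₗ (HopfAlgebra.antipode k).lTensor H) ∘ₗ
          A.tensorIncl.toLinearMap :=
      TensorProduct.ext' fun _ _ ↦ rfl
    refine LinearMap.ext fun a ↦ A.val_injective ?_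
    have h := LinearMap.congr_fun e (A.comulHom a)
    refine h.trans ?_
    change LinearMap.mul' k H ((HopfAlgebra.antipode k).lTensor H
      (A.tensorIncl (A.comulHom a))) = _
    rw [A.tensorIncl_comulHom]
    exact HopfAlgebra.mul_antipode_lTensor_comul_apply (R := k) (a : H)

end HopfSubalgebra

variable {H} in
/-- The Hopf subalgebra generated by a subset `s`, as a subalgebra: the intersection of all Hopf
subalgebras containing `s`. -/
def hopfClosure (s : Set H) : Subalgebra k H :=
  sInf {B | ∃ A : HopfSubalgebra k H, A.toSubalgebra = B ∧ s ⊆ B}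

/-! ### Primitive and anti-cocommutative elements -/

/-- The linear map `δ(h) = Δ(h) - (h ⊗ 1 + 1 ⊗ h)`. -/
def delta : H →ₗ[k] H ⊗[k] H :=
  Coalgebra.comul - ((TensorProduct.mk k H H).flip 1 + TensorProduct.mk k H H 1)

attribute [local instance 100] LieRing.ofAssociativeRing

/-- The Lie algebra `P(H) = {x | Δ(x) = x ⊗ 1 + 1 ⊗ x}` of primitive elements, with the commutator
bracket. -/
def primitives : LieSubalgebra k H where
  carrier := {x | Coalgebra.comul (R := k) x = x ⊗ₜ[k] 1 + 1 ⊗ₜ[k] x}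
  zero_mem' := by simp
  add_mem' {x y} hx hy := by
    change Coalgebra.comul (R := k) x = _ at hx
    change Coalgebra.comul (R := k) y = _ at hy
    change Coalgebra.comul (R := k) (x + y) = _
    rw [map_add, hx, hy, TensorProduct.add_tmul, TensorProduct.tmul_add]
    abel
  smul_mem' c x hx := by
    change Coalgebra.comul (R := k) x = _ at hx
    change Coalgebra.comul (R := k) (c • x) = _
    rw [map_smul, hx, smul_add, TensorProduct.smul_tmul', TensorProduct.tmul_smul]
  lie_mem' {x y} hx hy := by
    change Coalgebra.comul (R := k) x = _ at hx
    change Coalgebra.comul (R := k) y = _ at hy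
    change Coalgebra.comul (R := k) ⁅x, y⁆ = _
    simp only [Ring.lie_def, map_sub, Bialgebra.comul_mul, hx, hy, mul_add, add_mul,
      Algebra.TensorProduct.tmul_mul_tmul, mul_one, one_mul, TensorProduct.sub_tmul,
      TensorProduct.tmul_sub]
    abel

/-- `P₂(H) = {c | τ(δ(c)) = -δ(c) and δ(c) ∈ P(H) ⊗ P(H)}`, where `τ` is the twist map. -/
def P₂ : Submodule k H where
  carrier := {c | TensorProduct.comm k H H (delta k H c) = -delta k H c ∧
    delta k H c ∈ LinearMap.range
      (TensorProduct.mapIncl (primitives k H).toSubmodule (primitives k H).toSubmodule)}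
  zero_mem' := ⟨by simp, by rw [map_zero]; exact zero_mem _⟩
  add_mem' {x y} hx hy := by
    refine ⟨?_, ?_⟩
    · rw [map_add, map_add, hx.1, hy.1, neg_add]
    · rw [map_add]
      exact add_mem hx.2 hy.2
  smul_mem' c x hx := by
    refine ⟨?_, ?_⟩
    · rw [map_smul, map_smul, hx.1, smul_neg]
    · rw [map_smul]
      exact Submodule.smul_mem _ c hx.2

/-- `U_H`: the Hopf subalgebra of `H` generated by the primitive elements. -/
def primitiveHopf : Subalgebra k H :=
  hopfClosure k (primitives k H : Set H)

/-! ### Connected Hopf algebras -/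

/-- `H` is connected: its coradical is `k · 1`. -/
def IsConnectedHopf : Prop :=
  coradical k H = Submodule.span k {1}

/-- `H` is locally finite: every term of the coradical filtration is finite-dimensional. -/
def IsLocallyFiniteHopf : Prop :=
  ∀ n, (coradicalFiltration k H n).FG

/-- A connected Hopf algebra `H` is primitively thick if `GK.dim H = dim P(H) + 1 < ∞`. -/
structure IsPrimitivelyThick : Prop where
  connected : IsConnectedHopf k H
  finite : Module.Finite k (primitives k H)
  gkDim_eq : gkDim k H = ((Module.finrank k (primitives k H) + 1 : ℕ) : EReal)

/-- `H` belongs to the class `𝒜(𝔤)`: it is a locally finite connected Hopf algebra, generated by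
`P₂(H)` as a Hopf algebra, with `P(H) ≅ 𝔤` finite-dimensional and `H ≠ U_H`. -/
structure MemClassA (𝔤 : Type*) [LieRing 𝔤] [LieAlgebra k 𝔤] : Prop where
  connected : IsConnectedHopf k H
  locallyFinite : IsLocallyFiniteHopf k H
  finite : Module.Finite k 𝔤
  primitives_equiv : Nonempty (𝔤 ≃ₗ⁅k⁆ primitives k H)
  generated : hopfClosure k (P₂ k H : Set H) = ⊤
  ne_primitiveHopf : primitiveHopf k H ≠ ⊤

end Hopf

end ConnHopf

end

/-! Since `H` is generated by `P₂(H)` and `H ≠ U_H`, the quotient `P₂(H)/P(H)` is a nonzero module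
over the solvable Lie algebra `P(H)`, and it is finite-dimensional because `δ` embeds it in `P(H) ⊗
P(H)`. Lie's theorem (`exists_eigenvector`) yields `c ∈ P₂(H)`, not primitive, with `[x, c] ∈ kc +
P(H)` for every primitive `x`. Hence `𝔥 = P(H) ⊕ kc` is a Lie subalgebra of `H`, and the subalgebra
`A` that it generates is a Hopf subalgebra because `δ(c) ∈ P(H) ⊗ P(H)`.

The substance is that the ordered monomials in `c` and a basis `x_1, …, x_n` of `P(H)` are linearly
independent (`orderedEval_injective`). Give each `x_i` weight 1 and `c` weight 2. Commutators of
generators have lower weight than the products, so elements of `A` have commutative symbols modulo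
lower weight. Contracting the left leg of `Δ(h)` with a linear form `ξ` and discarding `ξ(1)h`
lowers weight by one and acts on symbols as the derivation `x_j ↦ ξ(x_j)`, `c ↦ Σ ω_ij ξ(x_i) x_j`,
where `δ(c) = Σ ω_ij x_i ⊗ x_j`. As `δ(c)` is antisymmetric, `τ ∘ Δ` gives the same derivations with
`-ω`. If a homogeneous `f` is a symbol of zero, so are its images under both families, which vanish
by induction on the weight. Their difference and `ω ≠ 0` give `∂f/∂c = 0`, then every `∂f/∂x_i = 0`,
so `f` is constant in characteristic zero, and finally zero.

Independence makes `U(𝔥) → A` an isomorphism (`lift_bijective`), and counting monomials gives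
`GK.dim A = n + 1` (`gkDim_le_card`, `card_le_gkDim`), while `P(A)` is identified with `P(H)`. -/

noncomputable section

namespace ConnHopf

/-! ### Weight filtration and commutative symbols -/

section WeightFiltration

open MvPolynomial

variable {k B I : Type*} [Field k] [Ring B] [Algebra k B] (e : I → B) (w : I → ℕ)

variable (k) in
/-- The span of the products of generators of total weight less than `m`. -/
def weightLT (m : ℤ) : Submodule k B :=
  Submodule.span k {b | ∃ l : List I, ((l.map w).sum : ℤ) < m ∧ b = (l.map e).prod}

variable (k) in
/-- Pairs `(f, b)` where `f` is homogeneous of weight `m` and `b` is, up to terms of weight less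
than `m`, the value at the generators of a noncommutative lift of `f`. -/
def symbolRel (m : ℤ) : Submodule k (MvPolynomial I k × B) :=
  Submodule.span k {p | (∃ l : List I, ((l.map w).sum : ℤ) = m ∧
    p = ((l.map X).prod, (l.map e).prod)) ∨ (p.1 = 0 ∧ p.2 ∈ weightLT k e w m)}

variable {e w}

theorem prod_mem_weightLT {l : List I} {m : ℤ} (h : ((l.map w).sum : ℤ) < m) :
    (l.map e).prod ∈ weightLT k e w m :=
  Submodule.subset_span ⟨l, h, rfl⟩

theorem weightLT_mono {m n : ℤ} (h : m ≤ n) : weightLT k e w m ≤ weightLT k e w n :=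
  Submodule.span_mono fun _ ⟨l, hl, hb⟩ ↦ ⟨l, hl.trans_le h, hb⟩

theorem weightLT_of_nonpos {m : ℤ} (h : m ≤ 0) : weightLT k e w m = ⊥ := by
  rw [eq_bot_iff, weightLT, Submodule.span_le]
  rintro _ ⟨l, hl, -⟩
  omega

theorem mul_mem_weightLT {m n : ℤ} {a b : B} (ha : a ∈ weightLT k e w m)
    (hb : b ∈ weightLT k e w n) : a * b ∈ weightLT k e w (m + n - 1) := by
  have h := Submodule.mul_mem_mul ha hb
  rw [weightLT, weightLT, Submodule.span_mul_span] at h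
  refine Submodule.span_mono ?_ h
  rintro _ ⟨_, ⟨l, hl, rfl⟩, _, ⟨l', hl', rfl⟩, rfl⟩
  refine ⟨l ++ l', ?_, by simp⟩
  simp only [List.map_append, List.sum_append, Nat.cast_add]
  omega

theorem mul_mem_weightLT_of_le {m n p : ℤ} {a b : B} (ha : a ∈ weightLT k e w m)
    (hb : b ∈ weightLT k e w n) (h : m + n - 1 ≤ p) : a * b ∈ weightLT k e w p :=
  weightLT_mono h (mul_mem_weightLT ha hb)

theorem gen_mem_weightLT (i : I) : e i ∈ weightLT k e w (w i + 1) := by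
  have := prod_mem_weightLT (k := k) (e := e) (w := w) (l := [i]) (m := w i + 1) (by simp)
  simpa using this

theorem one_mem_weightLT {m : ℤ} (h : 0 < m) : (1 : B) ∈ weightLT k e w m := by
  simpa using prod_mem_weightLT (k := k) (e := e) (w := w) (l := []) (m := m) (by simpa)

theorem list_mem_symbolRel (l : List I) :
    ((l.map X).prod, (l.map e).prod) ∈ symbolRel k e w ((l.map w).sum : ℤ) :=
  Submodule.subset_span (Or.inl ⟨l, rfl, rfl⟩)

theorem lower_mem_symbolRel {m : ℤ} {b : B} (h : b ∈ weightLT k e w m) :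
    ((0 : MvPolynomial I k), b) ∈ symbolRel k e w m :=
  Submodule.subset_span (Or.inr ⟨rfl, h⟩)

theorem gen_mem_symbolRel (i : I) :
    ((X i : MvPolynomial I k), e i) ∈ symbolRel k e w (w i) := by
  simpa using list_mem_symbolRel (k := k) (e := e) (w := w) [i]

theorem snd_mem_of_mem_symbolRel {m : ℤ} {p : MvPolynomial I k × B}
    (hp : p ∈ symbolRel k e w m) : p.2 ∈ weightLT k e w (m + 1) := by
  have : symbolRel k e w m ≤ (weightLT k e w (m + 1)).comap (LinearMap.snd k _ _) := by
    refine Submodule.span_le.2 ?_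
    rintro _ (⟨l, hl, rfl⟩ | ⟨-, h⟩)
    · exact prod_mem_weightLT (by omega)
    · exact weightLT_mono (by omega) h
  exact this hp

/-- A remainder of lower weight stays of lower weight after multiplication by any element of the
filtration, so errors never reach the leading term of a product. -/
theorem mul_mem_symbolRel {m n : ℤ} {p q : MvPolynomial I k × B}
    (hp : p ∈ symbolRel k e w m) (hq : q ∈ symbolRel k e w n) :
    p * q ∈ symbolRel k e w (m + n) := by
  have h := Submodule.mul_mem_mul hp hq
  nth_rw 1 [symbolRel] at h
  nth_rw 1 [symbolRel] at h
  rw [Submodule.span_mul_span] at h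
  refine Submodule.span_mono ?_ h
  rintro _ ⟨p, hp, q, hq, rfl⟩
  have hp' := snd_mem_of_mem_symbolRel (Submodule.subset_span hp)
  have hq' := snd_mem_of_mem_symbolRel (Submodule.subset_span hq)
  rcases hp with ⟨l, hl, rfl⟩ | ⟨hp1, hp2⟩
  · rcases hq with ⟨l', hl', rfl⟩ | ⟨hq1, hq2⟩
    · exact Or.inl ⟨l ++ l', by simp [← hl, ← hl'], by simp⟩
    · exact Or.inr ⟨by simp [hq1], mul_mem_weightLT_of_le hp' hq2 (by omega)⟩
  · exact Or.inr ⟨by simp [hp1], mul_mem_weightLT_of_le hp2 hq' (by omega)⟩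

theorem constantCoeff_of_mem_symbolRel {m : ℤ} (hm : m ≠ 0) {p : MvPolynomial I k × B}
    (hp : p ∈ symbolRel k e w m) : constantCoeff p.1 = 0 := by
  have : symbolRel k e w m ≤
      (LinearMap.ker (MvPolynomial.lcoeff (R := k) (0 : I →₀ ℕ))).comap (LinearMap.fst k _ _) := by
    refine Submodule.span_le.2 ?_
    rintro _ (⟨l, hl, rfl⟩ | ⟨h, -⟩)
    · cases l with
      | nil => simp at hl; omega
      | cons i l =>
        change coeff 0 _ = (0 : k)
        rw [← constantCoeff_eq]
        simp
    · change coeff 0 _ = (0 : k)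
      simp [h]
  exact this hp

variable (e) in
/-- A linear map sending every monomial to a product of the generators that it lists, in some
order. -/
def orderedEval : MvPolynomial I k →ₗ[k] B :=
  (basisMonomials I k).constr k fun s ↦ ((Finsupp.toMultiset s).toList.map e).prod

theorem orderedEval_monomial (s : I →₀ ℕ) :
    orderedEval e (monomial s (1 : k)) = ((Finsupp.toMultiset s).toList.map e).prod := by
  have := (basisMonomials I k).constr_basis k
    (fun s ↦ ((Finsupp.toMultiset s).toList.map e).prod) s
  rw [coe_basisMonomials] at this
  exact this

theorem orderedEval_C (a : k) : orderedEval e (C a) = a • (1 : B) := by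
  rw [C_apply, ← mul_one a, ← smul_eq_mul, ← smul_monomial, map_smul, orderedEval_monomial]
  simp

theorem prod_X_toList (s : I →₀ ℕ) :
    ((Finsupp.toMultiset s).toList.map X).prod = (monomial s (1 : k)) := by
  rw [← Multiset.prod_coe, ← Multiset.map_coe, Multiset.coe_toList, Finsupp.toMultiset_map,
    Finsupp.prod_toMultiset, monomial_eq]
  simp [Finsupp.prod_mapDomain_index, pow_add]

theorem exists_monomial_eq_prod_X (l : List I) : ∃ s : I →₀ ℕ,
    (l.map X).prod = monomial s (1 : k) ∧ l.Perm (Finsupp.toMultiset s).toList := by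
  classical
  have h : l.Perm (Finsupp.toMultiset (Multiset.toFinsupp (l : Multiset I))).toList := by
    rw [Multiset.toFinsupp_toMultiset]
    exact (Multiset.coe_eq_coe.1 (Multiset.coe_toList _)).symm
  exact ⟨_, by rw [← prod_X_toList, (h.map X).prod_eq], h⟩

theorem sum_weight_toList (s : I →₀ ℕ) :
    ((Finsupp.toMultiset s).toList.map w).sum = Finsupp.weight w s := by
  rw [← Multiset.sum_coe, ← Multiset.map_coe, Multiset.coe_toList, Finsupp.toMultiset_map,
    Finsupp.sum_toMultiset, Finsupp.weight_apply]
  simp [Finsupp.sum_mapDomain_index, add_mul]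

theorem monomial_mem_symbolRel (s : I →₀ ℕ) :
    (monomial s (1 : k), orderedEval e (monomial s (1 : k))) ∈
      symbolRel k e w (Finsupp.weight w s : ℕ) := by
  rw [orderedEval_monomial, ← prod_X_toList, ← sum_weight_toList]
  exact list_mem_symbolRel _

theorem orderedEval_mem_weightLT {f : MvPolynomial I k} {m : ℤ}
    (hf : ∀ s ∈ f.support, (Finsupp.weight w s : ℤ) < m) :
    orderedEval e f ∈ weightLT k e w m := by
  rw [f.as_sum, map_sum]
  refine Submodule.sum_mem _ fun s hs ↦ ?_
  rw [← mul_one (coeff s f), ← smul_eq_mul, ← smul_monomial, map_smul, orderedEval_monomial]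
  exact Submodule.smul_mem _ _ (prod_mem_weightLT (by rw [sum_weight_toList]; exact hf s hs))

theorem mem_symbolRel_of_isWeightedHomogeneous {f : MvPolynomial I k} {m : ℕ}
    (hf : IsWeightedHomogeneous w f m) : (f, orderedEval e f) ∈ symbolRel k e w m := by
  have : (f, orderedEval e f) = ∑ s ∈ f.support,
      coeff s f • (monomial s (1 : k), orderedEval e (monomial s (1 : k))) := by
    refine Prod.ext ?_ ?_
    · simp only [Prod.fst_sum, Prod.smul_fst, smul_monomial, smul_eq_mul, mul_one]
      exact f.as_sum
    · simp only [Prod.snd_sum, Prod.smul_snd, ← map_smul, smul_eq_mul, mul_one,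
        ← map_sum]
      rw [← f.as_sum]
  rw [this]
  refine Submodule.sum_mem _ fun s hs ↦ Submodule.smul_mem _ _ ?_
  rw [← hf (mem_support_iff.1 hs)]
  exact monomial_mem_symbolRel s

section Commutator

variable (hcomm : ∀ i j, e i * e j - e j * e i ∈ weightLT k e w (w i + w j))
include hcomm

/-- Swapping adjacent letters costs a commutator, of weight strictly below that of the two letters
together, and every permutation is a chain of such swaps. -/
theorem prod_sub_prod_mem_of_perm {l l' : List I} (h : l.Perm l') :
    (l.map e).prod - (l'.map e).prod ∈ weightLT k e w ((l.map w).sum : ℤ) := by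
  induction h with
  | nil => simp
  | cons i h ih =>
    simp only [List.map_cons, List.prod_cons, ← mul_sub, List.sum_cons, Nat.cast_add]
    exact mul_mem_weightLT_of_le (gen_mem_weightLT i) ih (by omega)
  | swap i j l =>
    simp only [List.map_cons, List.prod_cons, List.sum_cons, Nat.cast_add, ← mul_assoc, ← sub_mul]
    exact mul_mem_weightLT_of_le (hcomm j i)
      (prod_mem_weightLT (l := l) (m := (l.map w).sum + 1) (by omega)) (by omega)
  | trans h₁ h₂ ih₁ ih₂ =>
    rw [← sub_add_sub_cancel]
    refine add_mem ih₁ ?_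
    rwa [(h₁.map w).sum_eq]

theorem sub_orderedEval_mem {m : ℤ} {p : MvPolynomial I k × B} (hp : p ∈ symbolRel k e w m) :
    p.2 - orderedEval e p.1 ∈ weightLT k e w m := by
  have : symbolRel k e w m ≤ (weightLT k e w m).comap
      (LinearMap.snd k _ _ - (orderedEval e).comp (LinearMap.fst k _ _)) := by
    refine Submodule.span_le.2 ?_
    rintro _ (⟨l, rfl, rfl⟩ | ⟨h, h'⟩)
    · change (l.map e).prod - orderedEval e (l.map (X (R := k))).prod ∈ weightLT k e w _
      obtain ⟨s, hs, hl⟩ := exists_monomial_eq_prod_X (k := k) l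
      rw [hs, orderedEval_monomial]
      exact prod_sub_prod_mem_of_perm hcomm hl
    · simpa [h] using h'
  exact this hp

/-- Putting a word in order changes it only by terms of lower weight, which the induction has
already expressed through ordered monomials. -/
theorem weightLT_le_map (n : ℕ) : weightLT k e w n ≤
    (Submodule.span k {f | ∃ s : I →₀ ℕ, Finsupp.weight w s < n ∧ f = monomial s (1 : k)}).map
      (orderedEval e) := by
  induction n with
  | zero => simp [weightLT_of_nonpos]
  | succ n ih =>
    refine Submodule.span_le.2 ?_
    rintro _ ⟨l, hl, rfl⟩
    have h := sub_orderedEval_mem hcomm (list_mem_symbolRel (k := k) (e := e) (w := w) l)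
    have h2 := ih (weightLT_mono (n := (n : ℤ)) (by rw [Nat.cast_succ] at hl; omega) h)
    have hmono := Submodule.map_mono (f := orderedEval (k := k) e) (Submodule.span_mono (R := k)
      (s := {f | ∃ s : I →₀ ℕ, Finsupp.weight w s < n ∧ f = monomial s (1 : k)})
      (t := {f | ∃ s : I →₀ ℕ, Finsupp.weight w s < n + 1 ∧ f = monomial s (1 : k)})
      fun f ⟨s, hs, hf⟩ ↦ ⟨s, hs.trans (Nat.lt_succ_self n), hf⟩)
    have h3 := hmono h2
    rw [SetLike.mem_coe, ← sub_add_cancel (l.map e).prod (orderedEval e (l.map (X (R := k))).prod)]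
    refine add_mem h3 (Submodule.mem_map_of_mem (Submodule.subset_span ?_))
    obtain ⟨s, hs, hl'⟩ := exists_monomial_eq_prod_X (k := k) l
    refine ⟨_, ?_, hs⟩
    rw [← sum_weight_toList, ← (hl'.map w).sum_eq]
    exact_mod_cast hl

/-- The spanning half of a PBW theorem. -/
theorem adjoin_le_range_orderedEval :
    Subalgebra.toSubmodule (Algebra.adjoin k (Set.range e)) ≤ LinearMap.range (orderedEval e) := by
  rw [Algebra.adjoin_eq_span, Submodule.span_le]
  intro b hb
  obtain ⟨l, rfl⟩ : ∃ l : List I, b = (l.map e).prod := by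
    induction hb using Submonoid.closure_induction with
    | mem x hx => obtain ⟨i, rfl⟩ := hx; exact ⟨[i], by simp⟩
    | one => exact ⟨[], rfl⟩
    | mul x y _ _ hx hy =>
      obtain ⟨l, rfl⟩ := hx
      obtain ⟨l', rfl⟩ := hy
      exact ⟨l ++ l', by simp⟩
  have := weightLT_le_map (w := w) hcomm ((l.map w).sum + 1)
    (prod_mem_weightLT (k := k) (by rw [Nat.cast_succ]; omega) : (l.map e).prod ∈ _)
  obtain ⟨f, -, hf⟩ := this
  exact ⟨f, hf⟩

end Commutator

end WeightFiltration

/-! ### Contracted comultiplication as a derivation on symbols -/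

section Contraction

variable {k H : Type*} [Field k] [Ring H] [Algebra k H]

/-- The contraction `H ⊗ H → H` of the left factor with a linear form. -/
def contractLeft (ξ : H →ₗ[k] k) : H ⊗[k] H →ₗ[k] H :=
  (TensorProduct.lid k H).toLinearMap ∘ₗ ξ.rTensor H

@[simp]
theorem contractLeft_tmul (ξ : H →ₗ[k] k) (a b : H) : contractLeft ξ (a ⊗ₜ[k] b) = ξ a • b := by
  simp [contractLeft]

/-- A left factor passes through the contraction at the price of changing `ξ`; inductions on words
must therefore treat all forms at once. -/
theorem contractLeft_tmul_mul (ξ : H →ₗ[k] k) (a b : H) (t : H ⊗[k] H) :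
    contractLeft ξ (a ⊗ₜ[k] b * t) = b * contractLeft (ξ ∘ₗ LinearMap.mulLeft k a) t := by
  induction t with
  | zero => simp
  | add t t' h h' => rw [mul_add, map_add, map_add, mul_add, h, h']
  | tmul c d => simp

end Contraction

section Quadratic

open MvPolynomial

variable {k H J : Type*} [Field k] [Ring H] [Algebra k H]

/-- The weights: one for the primitive generators, two for the additional one. -/
def optionWeight : Option J → ℕ
  | none => 2
  | some _ => 1

variable [Fintype J]

/-- The derivation of the symmetric algebra that is the symbol of the contraction of the
comultiplication with `ξ`. -/
def symbolDeriv (e : Option J → H) (ω : J → J → k) (ξ : H →ₗ[k] k) :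
    Derivation k (MvPolynomial (Option J) k) (MvPolynomial (Option J) k) :=
  mkDerivation k fun
    | none => ∑ i, ∑ j, (ω i j * ξ (e (some i))) • X (some j)
    | some j => C (ξ (e (some j)))

variable {e : Option J → H} {ω : J → J → k} {T : H →ₐ[k] H ⊗[k] H}
  (hx : ∀ j, T (e (some j)) = e (some j) ⊗ₜ[k] 1 + 1 ⊗ₜ[k] e (some j))
  (hc : T (e none) = e none ⊗ₜ[k] 1 + 1 ⊗ₜ[k] e none +
    ∑ i, ∑ j, ω i j • (e (some i) ⊗ₜ[k] e (some j)))
include hx hc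

/-- This is the Leibniz rule on words. In `T (e a)`, the summand `1 ⊗ e a` keeps the first letter
and differentiates the rest, while the other summands differentiate the first letter. Subtracting `ξ
1` times the word removes the only term of full weight. -/
theorem symbolDeriv_mem_symbolRel (l : List (Option J)) (ξ : H →ₗ[k] k) :
    (symbolDeriv e ω ξ (l.map X).prod,
      contractLeft ξ (T (l.map e).prod) - ξ 1 • (l.map e).prod) ∈
      symbolRel k e optionWeight ((l.map optionWeight).sum - 1) := by
  induction l generalizing ξ with
  | nil =>
    simp only [List.map_nil, List.prod_nil, Derivation.map_one_eq_zero, map_one,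
      Algebra.TensorProduct.one_def, contractLeft_tmul, sub_self]
    exact zero_mem _
  | cons a l ih =>
    set p := (l.map e).prod
    set m : ℤ := Nat.cast (l.map optionWeight).sum
    set f : MvPolynomial (Option J) k := (l.map X).prod
    have hlist : (f, p) ∈ symbolRel k e optionWeight m := list_mem_symbolRel l
    have hD (η : H →ₗ[k] k) : contractLeft η (T p) - η 1 • p ∈ weightLT k e optionWeight m := by
      have := snd_mem_of_mem_symbolRel (ih η)
      rwa [sub_add_cancel] at this
    have hlist' (η : H →ₗ[k] k) :
        (η 1 • f, contractLeft η (T p)) ∈ symbolRel k e optionWeight m := by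
      have := add_mem (Submodule.smul_mem _ (η 1) hlist) (lower_mem_symbolRel (hD η))
      simpa using this
    have hgen : ((X a : MvPolynomial (Option J) k), e a) *
        (symbolDeriv e ω ξ f, contractLeft ξ (T p) - ξ 1 • p) ∈
        symbolRel k e optionWeight (((a :: l).map optionWeight).sum - 1) := by
      have := mul_mem_symbolRel (gen_mem_symbolRel (k := k) (e := e) (w := optionWeight) a) (ih ξ)
      convert this using 1
      congr 1; simp [m]; ring
    rcases a with _ | a
    -- The summand `e none ⊗ 1` deletes a letter of weight two, so it falls below the expected
    -- weight and leaves no trace in the symbol.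
    · have h1 : ((0 : MvPolynomial (Option J) k),
          contractLeft (ξ ∘ₗ LinearMap.mulLeft k (e none)) (T p)) ∈
          symbolRel k e optionWeight (((none :: l).map optionWeight).sum - 1) := by
        refine lower_mem_symbolRel (weightLT_mono ?_ (snd_mem_of_mem_symbolRel (hlist' _)))
        simp [m, optionWeight]; omega
      -- The quadratic part replaces `e none` by a single `e (some j)`, a drop in weight of exactly
      -- one.
      have h2 (i j : J) : (ξ (e (some i)) • (X (some j) * f),
          e (some j) * contractLeft (ξ ∘ₗ LinearMap.mulLeft k (e (some i))) (T p)) ∈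
          symbolRel k e optionWeight (((none :: l).map optionWeight).sum - 1) := by
        have := mul_mem_symbolRel (gen_mem_symbolRel (k := k) (e := e) (w := optionWeight) (some j))
          (hlist' (ξ ∘ₗ LinearMap.mulLeft k (e (some i))))
        convert this using 1
        · congr 1; simp [m, optionWeight]; ring
        · simp
      have h3 := add_mem (add_mem h1 hgen) (Submodule.sum_mem _ fun i (_ : i ∈ Finset.univ) ↦
        Submodule.sum_mem _ fun j (_ : j ∈ Finset.univ) ↦ Submodule.smul_mem _ (ω i j) (h2 i j))
      convert h3 using 1
      refine Prod.ext ?_ ?_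
      · simp only [List.map_cons, List.prod_cons, Derivation.leibniz, symbolDeriv,
          mkDerivation_X, Prod.fst_add, Prod.fst_sum, Prod.smul_fst, Prod.fst_mul, zero_add,
          smul_eq_mul]
        congr 1
        rw [Finset.mul_sum]
        refine Finset.sum_congr rfl fun i _ ↦ ?_
        rw [Finset.mul_sum]
        refine Finset.sum_congr rfl fun j _ ↦ ?_
        rw [mul_smul_comm, mul_smul, mul_comm f]
      · simp only [List.map_cons, List.prod_cons, map_mul, hc, add_mul, map_add,
          contractLeft_tmul_mul, Finset.sum_mul, map_sum, Prod.snd_add, Prod.snd_sum,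
          Prod.smul_snd, Prod.snd_mul, smul_mul_assoc, map_smul, one_mul, mul_sub]
        have : ξ ∘ₗ LinearMap.mulLeft k (1 : H) = ξ := by ext; simp
        rw [this, mul_smul_comm]
        abel
    · have h1 : (ξ (e (some a)) • f, contractLeft (ξ ∘ₗ LinearMap.mulLeft k (e (some a))) (T p)) ∈
          symbolRel k e optionWeight (((some a :: l).map optionWeight).sum - 1) := by
        convert hlist' (ξ ∘ₗ LinearMap.mulLeft k (e (some a))) using 1
        · simp [m, optionWeight]
        · simp
      have h3 := add_mem h1 hgen
      convert h3 using 1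
      refine Prod.ext ?_ ?_
      · simp only [List.map_cons, List.prod_cons, Derivation.leibniz, symbolDeriv,
          mkDerivation_X, Prod.fst_add, Prod.fst_mul, smul_eq_mul]
        rw [smul_eq_C_mul]
        ring
      · simp only [List.map_cons, List.prod_cons, map_mul, hx, add_mul, map_add,
          contractLeft_tmul_mul, Prod.snd_add, Prod.snd_mul, one_mul, mul_sub]
        have : ξ ∘ₗ LinearMap.mulLeft k (1 : H) = ξ := by ext; simp
        rw [this, mul_smul_comm]
        abel

theorem contractLeft_mem_weightLT (ξ : H →ₗ[k] k) {m : ℤ} {h : H}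
    (hh : h ∈ weightLT k e optionWeight m) :
    contractLeft ξ (T h) - ξ 1 • h ∈ weightLT k e optionWeight (m - 1) := by
  have : weightLT k e optionWeight m ≤ (weightLT k e optionWeight (m - 1)).comap
      (contractLeft ξ ∘ₗ T.toLinearMap - ξ 1 • LinearMap.id) := by
    refine Submodule.span_le.2 ?_
    rintro _ ⟨l, hl, rfl⟩
    exact weightLT_mono (by omega)
      (snd_mem_of_mem_symbolRel (symbolDeriv_mem_symbolRel hx hc l ξ))
  exact this hh

theorem symbolDeriv_mem_symbolRel_of_mem (ξ : H →ₗ[k] k) {m : ℤ}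
    {q : MvPolynomial (Option J) k × H} (hq : q ∈ symbolRel k e optionWeight m) :
    (symbolDeriv e ω ξ q.1, contractLeft ξ (T q.2) - ξ 1 • q.2) ∈
      symbolRel k e optionWeight (m - 1) := by
  have : symbolRel k e optionWeight m ≤ (symbolRel k e optionWeight (m - 1)).comap
      (LinearMap.prodMap (symbolDeriv e ω ξ).toLinearMap
        (contractLeft ξ ∘ₗ T.toLinearMap - ξ 1 • LinearMap.id)) := by
    refine Submodule.span_le.2 ?_
    rintro _ (⟨l, rfl, rfl⟩ | ⟨h, h'⟩)
    · exact symbolDeriv_mem_symbolRel hx hc l ξ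
    · rename_i q
      change (symbolDeriv e ω ξ q.1, _) ∈ symbolRel k e optionWeight (m - 1)
      rw [h, map_zero]
      exact lower_mem_symbolRel (contractLeft_mem_weightLT hx hc ξ h')
  exact this hq

end Quadratic

/-! ### Linear independence of the ordered monomials -/

section Injective

open MvPolynomial

variable {k H J : Type*} [Field k] [CharZero k] [Ring H] [Algebra k H] [Fintype J]

theorem eq_C_of_pderiv_eq_zero {I : Type*} {f : MvPolynomial I k} (h : ∀ i, pderiv i f = 0) :
    f = C (constantCoeff f) := by
  classical
  ext s
  rw [coeff_C]
  split_ifs with hs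
  · rw [← hs, constantCoeff_eq]
  · obtain ⟨i, hi⟩ : ∃ i, s i ≠ 0 := by
      by_contra! h'
      exact hs (Finsupp.ext h').symm
    -- The coefficient of `f` at `s` reappears in `pderiv i f` multiplied by `s i`, which is nonzero
    -- in characteristic zero.
    have := coeff_pderiv (i := i) f (s - Finsupp.single i 1)
    rw [h i, coeff_zero] at this
    have hle : Finsupp.single i 1 ≤ s := by
      rw [Finsupp.single_le_iff]; omega
    rw [tsub_add_cancel_of_le hle] at this
    rcases mul_eq_zero.1 this.symm with h' | h'
    · exact h'
    · exfalso
      norm_cast at h'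

variable {e : Option J → H} {ω : J → J → k} {T T' : H →ₐ[k] H ⊗[k] H}

theorem derivation_sum_apply {R A M ι : Type*} [CommSemiring R] [CommSemiring A]
    [AddCommMonoid M] [Algebra R A] [Module A M] [Module R M] (s : Finset ι)
    (D : ι → Derivation R A M) (a : A) : (∑ i ∈ s, D i) a = ∑ i ∈ s, D i a := by
  classical
  induction s using Finset.induction_on with
  | empty => simp
  | insert i s hi ih => rw [Finset.sum_insert hi, Finset.sum_insert hi, Derivation.add_apply, ih]

omit [CharZero k] in
theorem symbolDeriv_eq_sum_pderiv (ξ : H →ₗ[k] k) (f : MvPolynomial (Option J) k) :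
    symbolDeriv e ω ξ f = (∑ i, ∑ j, (ω i j * ξ (e (some i))) • X (some j)) * pderiv none f +
      ∑ j, ξ (e (some j)) • pderiv (some j) f := by
  classical
  have : symbolDeriv e ω ξ =
      (∑ i, ∑ j, (ω i j * ξ (e (some i))) • X (some j) : MvPolynomial (Option J) k) • pderiv none +
      ∑ j, ξ (e (some j)) • pderiv (some j) := by
    refine derivation_ext fun a ↦ ?_
    rcases a with _ | a
    · simp [symbolDeriv, mkDerivation_X, pderiv_X, derivation_sum_apply]
    · simp [symbolDeriv, mkDerivation_X, pderiv_X, Pi.single_apply, derivation_sum_apply,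
        smul_eq_C_mul]
  rw [this]
  simp [derivation_sum_apply]

/-- The two families differ only in the sign of the coefficient of `pderiv none`. For `ξ` dual to `e
(some i₀)`, their difference is `2 (Σ_j ω i₀ j X_j)` times `pderiv none f`, and the polynomial ring
is a domain. The other dual forms then isolate the remaining partial derivatives. -/
theorem eq_C_of_symbolDeriv_eq_zero (hlin : LinearIndependent k fun j ↦ e (some j))
    {i₀ j₀ : J} (hω : ω i₀ j₀ ≠ 0) {f : MvPolynomial (Option J) k}
    (h : ∀ ξ : H →ₗ[k] k, symbolDeriv e ω ξ f = 0)
    (h' : ∀ ξ : H →ₗ[k] k, symbolDeriv e (-ω) ξ f = 0) : f = C (constantCoeff f) := by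
  classical
  -- The coordinate forms on the span of the `e (some j)` extend to all of `H`.
  have hdual (i : J) : ∃ ξ : H →ₗ[k] k, ∀ j, ξ (e (some j)) = if j = i then 1 else 0 := by
    obtain ⟨ξ, hξ⟩ := LinearMap.exists_extend ((Finsupp.lapply i) ∘ₗ hlin.repr)
    refine ⟨ξ, fun j ↦ ?_⟩
    have := LinearMap.congr_fun hξ ⟨e (some j), Submodule.subset_span ⟨j, rfl⟩⟩
    simp only [LinearMap.comp_apply, Submodule.subtype_apply] at this
    rw [this, hlin.repr_eq_single j _ rfl]
    simp [Finsupp.single_apply]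
  have hnone : pderiv none f = 0 := by
    obtain ⟨ξ, hξ⟩ := hdual i₀
    have h1 := h ξ
    have h2 := h' ξ
    rw [symbolDeriv_eq_sum_pderiv] at h1 h2
    have h3 : (2 : MvPolynomial (Option J) k) * ((∑ j, ω i₀ j • X (some j)) * pderiv none f) = 0 := by
      have e1 : (∑ i, ∑ j, (ω i j * ξ (e (some i))) • X (some j) : MvPolynomial (Option J) k) =
          ∑ j, ω i₀ j • X (some j) := by
        rw [Finset.sum_eq_single i₀]
        · simp [hξ]
        · intro i _ hi; simp [hξ, hi]
        · simp
      have e2 : (∑ i, ∑ j, ((-ω) i j * ξ (e (some i))) • X (some j) : MvPolynomial (Option J) k) =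
          -∑ j, ω i₀ j • X (some j) := by
        rw [← e1]
        simp
      rw [e1] at h1
      rw [e2] at h2
      linear_combination h1 - h2
    rcases mul_eq_zero.1 h3 with h3 | h3
    · exact absurd h3 two_ne_zero
    rcases mul_eq_zero.1 h3 with h3 | h3
    · exfalso
      have := congrArg (coeff (Finsupp.single (some j₀) 1)) h3
      simp [coeff_sum, coeff_X, Finsupp.single_left_inj] at this
      exact hω this
    · exact h3
  refine eq_C_of_pderiv_eq_zero fun a ↦ ?_
  rcases a with _ | i
  · exact hnone
  · obtain ⟨ξ, hξ⟩ := hdual i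
    have h1 := h ξ
    rw [symbolDeriv_eq_sum_pderiv, hnone] at h1
    simpa [hξ] using h1

variable (hcomm : ∀ i j, e i * e j - e j * e i ∈
    weightLT k e optionWeight (optionWeight i + optionWeight j))
  (hx : ∀ j, T (e (some j)) = e (some j) ⊗ₜ[k] 1 + 1 ⊗ₜ[k] e (some j))
  (hc : T (e none) = e none ⊗ₜ[k] 1 + 1 ⊗ₜ[k] e none +
    ∑ i, ∑ j, ω i j • (e (some i) ⊗ₜ[k] e (some j)))
  (hx' : ∀ j, T' (e (some j)) = e (some j) ⊗ₜ[k] 1 + 1 ⊗ₜ[k] e (some j))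
  (hc' : T' (e none) = e none ⊗ₜ[k] 1 + 1 ⊗ₜ[k] e none +
    ∑ i, ∑ j, (-ω) i j • (e (some i) ⊗ₜ[k] e (some j)))
  (hlin : LinearIndependent k fun j ↦ e (some j)) (hω : ω ≠ 0)
include hcomm hx hc hx' hc' hlin hω

/-- The derivations of both families take symbols of zero in weight `d` to symbols of zero in weight
`d - 1`, so by induction `f` is constant. In nonzero weight the constant term vanishes; in weight
zero there are no lower terms, so the constant equals its value `0` in `H`. -/
theorem eq_zero_of_mem_symbolRel [Nontrivial H] (d : ℕ) {f : MvPolynomial (Option J) k}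
    (hf : (f, (0 : H)) ∈ symbolRel k e optionWeight d) : f = 0 := by
  obtain ⟨i₀, hi₀⟩ := Function.ne_iff.1 hω
  obtain ⟨j₀, hj₀⟩ := Function.ne_iff.1 hi₀
  suffices hz : ∀ n : ℕ, ∀ d : ℤ, d < n → ∀ f : MvPolynomial (Option J) k,
      (f, (0 : H)) ∈ symbolRel k e optionWeight d → f = 0 from
    hz (d + 1) d (by push_cast; omega) f hf
  intro n
  -- No word has negative weight, so only pairs with zero first component are left.
  have hneg : ∀ d : ℤ, d < 0 → ∀ f : MvPolynomial (Option J) k,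
      (f, (0 : H)) ∈ symbolRel k e optionWeight d → f = 0 := by
    intro d hd f hf
    have : symbolRel k e optionWeight d ≤ LinearMap.ker (LinearMap.fst k _ _) := by
      refine Submodule.span_le.2 ?_
      rintro _ (⟨l, hl, rfl⟩ | ⟨h, -⟩)
      · omega
      · exact h
    exact this hf
  induction n with
  | zero => exact fun d hd ↦ hneg d (by simpa using hd)
  | succ n ih =>
    intro d hd f hf
    rw [Nat.cast_succ] at hd
    have hconst : f = C (constantCoeff f) := by
      refine eq_C_of_symbolDeriv_eq_zero hlin hj₀ (fun ξ ↦ ?_) (fun ξ ↦ ?_)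
      · have := symbolDeriv_mem_symbolRel_of_mem hx hc ξ hf
        simp only [map_zero, smul_zero, sub_zero] at this
        exact ih (d - 1) (by omega) _ this
      · have := symbolDeriv_mem_symbolRel_of_mem hx' hc' ξ hf
        simp only [map_zero, smul_zero, sub_zero] at this
        exact ih (d - 1) (by omega) _ this
    rcases eq_or_ne d 0 with rfl | hd0
    · have h := sub_orderedEval_mem hcomm hf
      rw [weightLT_of_nonpos le_rfl, Submodule.mem_bot] at h
      dsimp only at h
      rw [hconst, orderedEval_C, zero_sub, neg_eq_zero, smul_eq_zero] at h
      rw [hconst, h.resolve_right one_ne_zero, map_zero]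
    · rw [hconst, constantCoeff_of_mem_symbolRel hd0 hf, map_zero]

/-- For a polynomial in the kernel, the component of top weight is a symbol of zero, since the other
components evaluate to lower weight. It can be removed, and the weight bound drops. -/
theorem orderedEval_injective [Nontrivial H] :
    Function.Injective (orderedEval (k := k) e) := by
  suffices hz : ∀ n : ℕ, ∀ f : MvPolynomial (Option J) k,
      (∀ s ∈ f.support, Finsupp.weight optionWeight s < n) → orderedEval e f = 0 → f = 0 by
    refine (injective_iff_map_eq_zero _).2 fun f hf ↦
      hz (f.support.sup (Finsupp.weight optionWeight) + 1) f (fun s hs ↦ ?_) hf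
    exact Nat.lt_succ_of_le (Finset.le_sup (f := Finsupp.weight optionWeight) hs)
  intro n
  induction n with
  | zero =>
    intro f hf _
    refine support_eq_empty.1 (Finset.eq_empty_of_forall_notMem fun s hs ↦ ?_)
    exact absurd (hf s hs) (Nat.not_lt_zero _)
  | succ n ih =>
    intro f hf h0
    set g := weightedHomogeneousComponent optionWeight n f
    have hrest : ∀ s ∈ (f - g).support, Finsupp.weight optionWeight s < n := by
      classical
      intro s hs
      rw [mem_support_iff, coeff_sub, coeff_weightedHomogeneousComponent] at hs
      by_cases h : Finsupp.weight optionWeight s = n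
      · simp [h] at hs
      · have := hf s (mem_support_iff.2 (by simpa [h] using hs))
        omega
    have hg : g = 0 := by
      refine eq_zero_of_mem_symbolRel hcomm hx hc hx' hc' hlin hω n ?_
      have h1 := mem_symbolRel_of_isWeightedHomogeneous (e := e)
        (weightedHomogeneousComponent_isWeightedHomogeneous (w := optionWeight) n f)
      have h2 := lower_mem_symbolRel (k := k)
        (orderedEval_mem_weightLT (e := e) (w := optionWeight) (m := n) (f := f - g)
          (by exact_mod_cast hrest))
      have h3 := add_mem h1 h2
      rw [map_sub, h0] at h3
      simpa [g] using h3
    refine ih f (fun s hs ↦ hrest s ?_) h0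
    rwa [hg, sub_zero]

end Injective

/-! ### Gelfand-Kirillov dimension by counting monomials -/

section Growth

open MvPolynomial Filter Topology

/-- Here `log (a n + b) = log n + log (a + b / n)` with bounded last term. Both the upper and the
lower estimate of the growth have this shape. -/
theorem tendsto_log_linear_div_log (N : ℕ) {a b : ℝ} (ha : 0 < a) (hb : 0 ≤ b) :
    Tendsto (fun n : ℕ ↦ N * Real.log (a * n + b) / Real.log n) atTop (𝓝 N) := by
  have hlog : Tendsto (fun n : ℕ ↦ Real.log n) atTop atTop :=
    Real.tendsto_log_atTop.comp tendsto_natCast_atTop_atTop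
  have h1 : Tendsto (fun n : ℕ ↦ Real.log (a + b / n)) atTop (𝓝 (Real.log a)) := by
    have : Tendsto (fun n : ℕ ↦ a + b / n) atTop (𝓝 (a + 0)) :=
      tendsto_const_nhds.add (tendsto_const_div_atTop_nhds_zero_nat b)
    rw [add_zero] at this
    exact this.log ha.ne'
  have h2 : Tendsto (fun n : ℕ ↦ N * (1 + Real.log (a + b / n) / Real.log n)) atTop
      (𝓝 (N * (1 + 0))) :=
    (tendsto_const_nhds.add (h1.div_atTop hlog)).const_mul _
  rw [add_zero, mul_one] at h2
  refine h2.congr' ?_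
  filter_upwards [eventually_ge_atTop 2] with n hn
  have hn0 : (0 : ℝ) < n := by positivity
  have hl : Real.log n ≠ 0 := (Real.log_pos (by exact_mod_cast hn)).ne'
  have : a * n + b = (a + b / n) * n := by field_simp
  rw [this, Real.log_mul (by positivity) hn0.ne']
  field_simp
  ring

variable {k B I : Type*} [Field k] [Ring B] [Algebra k B] {e : I → B} {w : I → ℕ}

theorem exists_weightLT_mem (hgen : Algebra.adjoin k (Set.range e) = ⊤) (b : B) :
    ∃ m : ℕ, b ∈ weightLT k e w m := by
  have hb : b ∈ Algebra.adjoin k (Set.range e) := hgen ▸ Algebra.mem_top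
  induction hb using Algebra.adjoin_induction with
  | mem x hx =>
    obtain ⟨i, rfl⟩ := hx
    exact ⟨w i + 1, by exact_mod_cast gen_mem_weightLT i⟩
  | algebraMap r =>
    refine ⟨1, ?_⟩
    rw [Algebra.algebraMap_eq_smul_one]
    exact Submodule.smul_mem _ _ (one_mem_weightLT (by simp))
  | add x y _ _ hx hy =>
    obtain ⟨m, hm⟩ := hx
    obtain ⟨n, hn⟩ := hy
    exact ⟨m + n, add_mem (weightLT_mono (by push_cast; omega) hm)
      (weightLT_mono (by push_cast; omega) hn)⟩
  | mul x y _ _ hx hy =>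
    obtain ⟨m, hm⟩ := hx
    obtain ⟨n, hn⟩ := hy
    exact ⟨m + n, mul_mem_weightLT_of_le hm hn (by push_cast; omega)⟩

theorem pow_le_weightLT {V : Submodule k B} {m : ℕ} (hV : V ≤ weightLT k e w m) (i : ℕ) :
    V ^ i ≤ weightLT k e w (m * i + 1 : ℕ) := by
  induction i with
  | zero =>
    rw [pow_zero, Submodule.one_le]
    exact one_mem_weightLT (by simp)
  | succ i ih =>
    rw [pow_succ, Submodule.mul_le]
    intro a ha b hb
    exact mul_mem_weightLT_of_le (ih ha) (hV hb) (by push_cast; linarith)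

variable [Fintype I]
  (hcomm : ∀ i j, e i * e j - e j * e i ∈ weightLT k e w (w i + w j)) (hw : ∀ i, 1 ≤ w i)

include hcomm hw in
-- As all weights are at least one, a monomial of weight below `n` has every exponent below `n`.
theorem exists_weightLT_le_span (n : ℕ) :
    ∃ s : Finset B, s.card ≤ n ^ Fintype.card I ∧ weightLT k e w n ≤ Submodule.span k s := by
  classical
  let F : (I → Fin n) → B := fun g ↦
    orderedEval e (monomial (Finsupp.equivFunOnFinite.symm fun i ↦ (g i : ℕ)) (1 : k))
  refine ⟨Finset.univ.image F, ?_, ?_⟩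
  · refine Finset.card_image_le.trans ?_
    simp
  · refine (weightLT_le_map hcomm n).trans ?_
    rw [Submodule.map_span, Submodule.span_le]
    rintro _ ⟨_, ⟨s, hs, rfl⟩, rfl⟩
    have hs' (i : I) : s i < n :=
      (Finsupp.le_weight w (Nat.one_le_iff_ne_zero.1 (hw i)) s).trans_lt hs
    refine Submodule.subset_span ?_
    rw [Finset.mem_coe, Finset.mem_image]
    refine ⟨fun i ↦ ⟨s i, hs' i⟩, Finset.mem_univ _, ?_⟩
    simp only [F]
    congr
    ext i
    simp

include hcomm hw in
theorem finrank_le_of_le_weightLT (n : ℕ) {V : Submodule k B} (hV : V ≤ weightLT k e w n) :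
    Module.finrank k V ≤ n ^ Fintype.card I := by
  obtain ⟨s, hs, hle⟩ := exists_weightLT_le_span hcomm hw n
  have : Module.Finite k (Submodule.span k (s : Set B)) := Module.Finite.span_finset k s
  exact (Submodule.finrank_mono (hV.trans hle)).trans ((finrank_span_finset_le_card s).trans hs)

variable (hgen : Algebra.adjoin k (Set.range e) = ⊤)
  (hinj : Function.Injective (orderedEval (k := k) e))

include hcomm hw hgen in
-- A finite-dimensional `V` has bounded weight `m`, so the sum of its powers up to `n` has dimension
-- at most `(m n + 1) ^ card I`.
theorem gkDim_le_card : gkDim k B ≤ (Fintype.card I : EReal) := by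
  refine iSup₂_le fun V hV ↦ ?_
  obtain ⟨m, hm⟩ : ∃ m : ℕ, V ≤ weightLT k e w m := by
    obtain ⟨s, rfl⟩ := hV
    choose f hf using exists_weightLT_mem (w := w) hgen
    refine ⟨s.sup f, Submodule.span_le.2 fun b hb ↦ ?_⟩
    exact weightLT_mono (by exact_mod_cast Finset.le_sup (f := f) hb) (hf b)
  have hlim := tendsto_log_linear_div_log (Fintype.card I) (a := m + 1) (b := 1)
    (by positivity) zero_le_one
  have hlim' := (continuous_coe_real_ereal.tendsto _).comp hlim
  have := hlim'.limsup_eq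
  rw [show (Fintype.card I : EReal) = ((Fintype.card I : ℝ) : EReal) by simp, ← this]
  refine limsup_le_limsup ?_
  filter_upwards [eventually_ge_atTop 2] with n hn
  refine EReal.coe_le_coe_iff.2 ?_
  have hl : 0 < Real.log n := Real.log_pos (by exact_mod_cast hn)
  refine div_le_div_of_nonneg_right ?_ hl.le
  have hle : (⨆ i ≤ n, V ^ i) ≤ weightLT k e w (m * n + 1 : ℕ) := by
    refine iSup₂_le fun i hi ↦ (pow_le_weightLT hm i).trans (weightLT_mono ?_)
    exact_mod_cast Nat.succ_le_succ (Nat.mul_le_mul_left m hi)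
  have hfr := finrank_le_of_le_weightLT hcomm hw _ hle
  -- Monotonicity of the logarithm needs a positive argument; for dimension zero the convention
  -- `Real.log 0 = 0` applies.
  rcases Nat.eq_zero_or_pos (Module.finrank k ↥(⨆ i ≤ n, V ^ i)) with h0 | h0
  · rw [h0, Nat.cast_zero, Real.log_zero]
    exact mul_nonneg (Nat.cast_nonneg _) (Real.log_nonneg (by
      have : (0 : ℝ) ≤ (m + 1) * n := by positivity
      linarith))
  · rw [← Real.log_pow]
    refine Real.log_le_log (by exact_mod_cast h0) ?_
    calc (Module.finrank k ↥(⨆ i ≤ n, V ^ i) : ℝ) ≤ ((m * n + 1 : ℕ) : ℝ) ^ Fintype.card I := by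
          exact_mod_cast hfr
      _ ≤ _ := by
          refine pow_le_pow_left₀ (by positivity) ?_ _
          push_cast
          have : (0 : ℝ) ≤ n := by positivity
          linarith

include hinj in
-- The span of the generators suffices: with `N` generators, the monomials whose exponents are all
-- at most `n / N` have length at most `n` and are independent, and they number at least `(n / N) ^
-- N` even for the real quotient.
theorem card_le_gkDim : (Fintype.card I : EReal) ≤ gkDim k B := by
  classical
  rcases isEmpty_or_nonempty I with hI | hI
  · have hnn : ∀ n : ℕ, (0 : EReal) ≤
        ((Real.log (Module.finrank k ↥(⨆ i ≤ n, (⊥ : Submodule k B) ^ i)) / Real.log n : ℝ) :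
          EReal) := fun n ↦
      EReal.coe_nonneg.2 (div_nonneg (Real.log_natCast_nonneg _) (Real.log_natCast_nonneg _))
    simp only [Fintype.card_eq_zero, Nat.cast_zero]
    refine le_iSup₂_of_le ⊥ Submodule.fg_bot ?_
    exact le_limsup_of_frequently_le (Frequently.of_forall hnn)
  set N := Fintype.card I
  have hN : 0 < N := Fintype.card_pos
  have hV : (Submodule.span k (Set.range e)).FG := Submodule.fg_span (Set.finite_range e)
  refine le_iSup₂_of_le _ hV ?_
  set V := Submodule.span k (Set.range e)
  have hlim := tendsto_log_linear_div_log N (a := (N : ℝ)⁻¹) (b := 0)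
    (by positivity) le_rfl
  have hlim' := (continuous_coe_real_ereal.tendsto _).comp hlim
  have := hlim'.limsup_eq
  rw [show (N : EReal) = ((N : ℝ) : EReal) by simp, ← this]
  refine limsup_le_limsup ?_
  filter_upwards [eventually_ge_atTop (2 + N)] with n hn
  refine EReal.coe_le_coe_iff.2 ?_
  have hl : 0 < Real.log n := Real.log_pos (by exact_mod_cast (by omega : 1 < n))
  refine div_le_div_of_nonneg_right ?_ hl.le
  rw [← Real.log_pow]
  have hn0 : (0 : ℝ) < n := by exact_mod_cast (by omega : 0 < n)
  refine Real.log_le_log (by positivity) ?_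
  let q := n / N
  let F : (I → Fin (q + 1)) → B := fun g ↦
    orderedEval e (monomial (Finsupp.equivFunOnFinite.symm fun i ↦ (g i : ℕ)) (1 : k))
  have hF : LinearIndependent k F := by
    have h1 := ((basisMonomials I k).linearIndependent.map' (orderedEval e)
      (LinearMap.ker_eq_bot.2 hinj)).comp
      (fun g : I → Fin (q + 1) ↦ Finsupp.equivFunOnFinite.symm fun i ↦ (g i : ℕ)) (by
        intro g g' h
        funext i
        have := DFunLike.congr_fun h i
        exact Fin.ext (by simpa using this))
    have h2 : F = ((orderedEval e) ∘ (basisMonomials I k)) ∘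
        (fun g : I → Fin (q + 1) ↦ Finsupp.equivFunOnFinite.symm fun i ↦ (g i : ℕ)) := by
      funext g
      simp [F]
    rw [h2]
    exact h1
  have hfg : (⨆ i ≤ n, V ^ i).FG := by
    have : (⨆ i ≤ n, V ^ i) = ⨆ i ∈ Finset.range (n + 1), V ^ i := by
      simp
    rw [this]
    exact Submodule.fg_biSup _ _ fun i _ ↦ hV.pow i
  have : Module.Finite k ↥(⨆ i ≤ n, V ^ i) := Module.Finite.iff_fg.2 hfg
  have hmem (g : I → Fin (q + 1)) : F g ∈ ⨆ i ≤ n, V ^ i := by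
    simp only [F]
    rw [orderedEval_monomial]
    set s : I →₀ ℕ := Finsupp.equivFunOnFinite.symm fun i ↦ (g i : ℕ)
    have hpow (l : List I) : (l.map e).prod ∈ V ^ l.length := by
      induction l with
      | nil => exact Submodule.one_le.1 (pow_zero V).ge
      | cons a l ih =>
        rw [List.map_cons, List.prod_cons, List.length_cons, pow_succ']
        exact Submodule.mul_mem_mul (Submodule.subset_span ⟨a, rfl⟩) ih
    refine Submodule.mem_iSup_of_mem _ (Submodule.mem_iSup_of_mem ?_ (hpow _))
    rw [Multiset.length_toList, Finsupp.card_toMultiset, Finsupp.sum_fintype _ _ (by simp)]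
    calc ∑ i, s i ≤ ∑ _i : I, q := Finset.sum_le_sum fun i _ ↦ by
          simpa [s] using Nat.lt_succ_iff.1 (g i).2
      _ = N * q := by simp [N]
      _ ≤ n := Nat.mul_div_le n N
  have hcard : (q + 1) ^ N ≤ Module.finrank k ↥(⨆ i ≤ n, V ^ i) := by
    have h1 : LinearIndependent k fun g ↦ (⟨F g, hmem g⟩ : ↥(⨆ i ≤ n, V ^ i)) :=
      LinearIndependent.of_comp (⨆ i ≤ n, V ^ i).subtype hF
    simpa [N] using h1.fintype_card_le_finrank
  calc ((N : ℝ)⁻¹ * n + 0) ^ N ≤ ((q + 1 : ℕ) : ℝ) ^ N := by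
        refine pow_le_pow_left₀ (by positivity) ?_ _
        rw [add_zero, inv_mul_eq_div, div_le_iff₀ (by exact_mod_cast hN)]
        have := Nat.lt_div_mul_add (a := n) hN
        have h3 : n ≤ (q + 1) * N := by
          rw [add_mul, one_mul]; exact this.le
        exact_mod_cast h3
    _ ≤ _ := by exact_mod_cast hcard

end Growth

/-! ### Hopf subalgebras: primitive elements and connectedness -/

section SubHopf

variable {k H : Type*} [Field k] [Ring H] [HopfAlgebra k H]

attribute [local instance 100] LieRing.ofAssociativeRing

theorem mem_primitives {x : H} :
    x ∈ primitives k H ↔ Coalgebra.comul (R := k) x = x ⊗ₜ[k] 1 + 1 ⊗ₜ[k] x := Iff.rfl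

theorem counit_of_mem_primitives {x : H} (hx : x ∈ primitives k H) :
    Coalgebra.counit (R := k) x = 0 := by
  have h := Coalgebra.rTensor_counit_comul (R := k) x
  rw [mem_primitives.1 hx, map_add, LinearMap.rTensor_tmul, LinearMap.rTensor_tmul,
    Bialgebra.counit_one, add_eq_right] at h
  have := congrArg (fun t ↦ TensorProduct.lid k k ((Coalgebra.counit (R := k)).lTensor k t)) h
  simpa using this

theorem nontrivial_of_hopfAlgebra (k H : Type*) [Field k] [Ring H] [HopfAlgebra k H] :
    Nontrivial H := by
  refine ⟨1, 0, fun h ↦ ?_⟩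
  have := congrArg (Coalgebra.counit (R := k)) h
  simp at this

theorem primitiveHopf_le (A : HopfSubalgebra k H)
    (hA : (primitives k H : Set H) ⊆ A.toSubalgebra) : primitiveHopf k H ≤ A.toSubalgebra :=
  sInf_le ⟨A, rfl, hA⟩

theorem isSubcoalgebra_span_one : IsSubcoalgebra k (Submodule.span k {(1 : H)}) := by
  intro d hd
  obtain ⟨a, rfl⟩ := Submodule.mem_span_singleton.1 hd
  rw [map_smul, Bialgebra.comul_one]
  refine Submodule.smul_mem _ _ ?_
  have h1 : (1 : H) ∈ Submodule.span k {(1 : H)} := Submodule.mem_span_singleton_self 1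
  exact ⟨⟨1, h1⟩ ⊗ₜ ⟨1, h1⟩, rfl⟩

theorem isSimpleSubcoalgebra_span_one : IsSimpleSubcoalgebra k (Submodule.span k {(1 : H)}) := by
  have := nontrivial_of_hopfAlgebra k H
  refine ⟨isSubcoalgebra_span_one, by simp, fun E _ hE ↦ ?_⟩
  exact ((nonzero_span_atom (K := k) (1 : H) one_ne_zero).le_iff).1 hE

namespace HopfSubalgebra

variable (A : HopfSubalgebra k H)

theorem tensorIncl_comul (a : A.toSubalgebra) :
    A.tensorIncl (Coalgebra.comul (R := k) a) = Coalgebra.comul (R := k) (a : H) :=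
  A.tensorIncl_comulHom a

theorem mem_primitives_iff (a : A.toSubalgebra) :
    a ∈ primitives k A.toSubalgebra ↔ (a : H) ∈ primitives k H := by
  rw [mem_primitives, mem_primitives, ← A.tensorIncl_comul, ← A.tensorIncl_injective.eq_iff]
  rfl

theorem map_mapIncl (E : Submodule k A.toSubalgebra) :
    (LinearMap.range (TensorProduct.mapIncl E E)).map A.tensorIncl.toLinearMap =
      LinearMap.range (TensorProduct.mapIncl (E.map A.toSubalgebra.val.toLinearMap)
        (E.map A.toSubalgebra.val.toLinearMap)) := by
  rw [TensorProduct.range_mapIncl, TensorProduct.range_mapIncl, Submodule.map_map₂,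
    Submodule.map₂_map_map]
  rfl

theorem isSubcoalgebra_map_iff (E : Submodule k A.toSubalgebra) :
    IsSubcoalgebra k (E.map A.toSubalgebra.val.toLinearMap) ↔ IsSubcoalgebra k E := by
  have key (d : A.toSubalgebra) : Coalgebra.comul (R := k) (d : H) ∈
      LinearMap.range (TensorProduct.mapIncl (E.map A.toSubalgebra.val.toLinearMap)
        (E.map A.toSubalgebra.val.toLinearMap)) ↔
      Coalgebra.comul (R := k) d ∈ LinearMap.range (TensorProduct.mapIncl E E) := by
    rw [← A.map_mapIncl, ← A.tensorIncl_comul]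
    exact Function.Injective.mem_set_image (s := (LinearMap.range (TensorProduct.mapIncl E E) :
      Set (A.toSubalgebra ⊗[k] A.toSubalgebra))) A.tensorIncl_injective
  constructor
  · exact fun h d hd ↦ (key d).1 (h d ⟨d, hd, rfl⟩)
  · rintro h _ ⟨d, hd, rfl⟩
    exact (key d).2 (h d hd)

/-- The inclusion carries simple subcoalgebras of `A` to simple subcoalgebras of `H`, and these lie
in `k · 1`. -/
theorem isConnectedHopf (h : IsConnectedHopf k H) : IsConnectedHopf k A.toSubalgebra := by
  refine le_antisymm (sSup_le fun D hD ↦ ?_) (le_sSup isSimpleSubcoalgebra_span_one)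
  have hsimple : IsSimpleSubcoalgebra k (D.map A.toSubalgebra.val.toLinearMap) := by
    refine ⟨(A.isSubcoalgebra_map_iff D).2 hD.1, ?_, fun E hE hle ↦ ?_⟩
    · intro h0
      refine hD.2.1 (Submodule.map_injective_of_injective
        (f := A.toSubalgebra.val.toLinearMap) A.val_injective ?_)
      exact h0.trans (Submodule.map_bot _).symm
    · obtain ⟨E', rfl⟩ : ∃ E' : Submodule k A.toSubalgebra,
          E'.map A.toSubalgebra.val.toLinearMap = E :=
        ⟨E.comap A.toSubalgebra.val.toLinearMap, Submodule.map_comap_eq_of_le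
          (hle.trans (LinearMap.map_le_range))⟩
      have hle' : E' ≤ D := (Submodule.map_le_map_iff_of_injective A.val_injective _ _).1 hle
      rcases hD.2.2 E' ((A.isSubcoalgebra_map_iff E').1 hE) hle' with rfl | rfl
      · exact Or.inl (Submodule.map_bot _)
      · exact Or.inr rfl
  have hle : D.map A.toSubalgebra.val.toLinearMap ≤ Submodule.span k {(1 : H)} :=
    (le_sSup (a := D.map A.toSubalgebra.val.toLinearMap) hsimple).trans (le_of_eq h)
  have : (Submodule.span k {(1 : A.toSubalgebra)}).map A.toSubalgebra.val.toLinearMap =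
      Submodule.span k {(1 : H)} := by
    rw [Submodule.map_span, Set.image_singleton]; rfl
  rw [← this] at hle
  exact (Submodule.map_le_map_iff_of_injective A.val_injective _ _).1 hle

/-- Passing to a Hopf subalgebra that contains all primitive elements does not change them. -/
def primitivesEquiv (hA : (primitives k H : Set H) ⊆ A.toSubalgebra) :
    primitives k A.toSubalgebra ≃ₗ[k] primitives k H where
  toFun a := ⟨a.1, (A.mem_primitives_iff a.1).1 a.2⟩
  invFun x := ⟨⟨x.1, hA x.2⟩, (A.mem_primitives_iff _).2 x.2⟩
  map_add' _ _ := rfl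
  map_smul' _ _ := rfl
  left_inv _ := rfl
  right_inv _ := rfl

end HopfSubalgebra

/-- A subalgebra generated by elements whose comultiplications and antipodes it contains is a Hopf
subalgebra. -/
def hopfAdjoin (s : Set H)
    (hcomul : ∀ a ∈ s, Coalgebra.comul (R := k) a ∈ (Algebra.TensorProduct.map
      (Algebra.adjoin k s).val (Algebra.adjoin k s).val).range)
    (hantipode : ∀ a ∈ s, HopfAlgebra.antipode k a ∈ Algebra.adjoin k s) : HopfSubalgebra k H where
  toSubalgebra := Algebra.adjoin k s
  comul_mem := by
    -- Since `Δ` is an algebra map, the elements it sends into the image of `A ⊗ A` form a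
    -- subalgebra, so generators suffice.
    have : Algebra.adjoin k s ≤ (Algebra.TensorProduct.map
      (Algebra.adjoin k s).val (Algebra.adjoin k s).val).range.comap
        (Bialgebra.comulAlgHom k H) := Algebra.adjoin_le hcomul
    exact this
  antipode_mem a ha := by
    induction ha using Algebra.adjoin_induction with
    | mem x hx => exact hantipode x hx
    | algebraMap r =>
      rw [Algebra.algebraMap_eq_smul_one, map_smul, HopfAlgebra.antipode_one]
      exact Subalgebra.smul_mem _ (one_mem _) r
    | add x y _ _ hx hy => rw [map_add]; exact add_mem hx hy
    | mul x y _ _ hx hy => rw [HopfAlgebra.antipode_mul_antidistrib]; exact mul_mem hy hx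

end SubHopf

attribute [local instance 100] LieRing.ofAssociativeRing

/-! ### Recognizing an enveloping algebra -/

section Enveloping

open MvPolynomial

variable {k I : Type*} [Field k]

theorem map_orderedEval {B C : Type*} [Ring B] [Algebra k B] [Ring C] [Algebra k C] (e : I → B)
    (f : B →ₐ[k] C) (p : MvPolynomial I k) : f (orderedEval e p) = orderedEval (f ∘ e) p := by
  have : f.toLinearMap ∘ₗ orderedEval e = orderedEval (k := k) (f ∘ e) := by
    refine (basisMonomials I k).ext fun s ↦ ?_
    simp [orderedEval_monomial, map_list_prod]
  exact LinearMap.congr_fun this p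

variable {𝔥 B : Type*} [LieRing 𝔥] [LieAlgebra k 𝔥] [Ring B] [Algebra k B]

/-- Stated for an arbitrary homomorphism `f` because it serves three targets: `U(𝔥)`, `H` and `A`.
-/
theorem commutator_mem_weightLT {b : I → 𝔥} {w : I → ℕ}
    (hb : ∀ i j, ⁅b i, b j⁆ ∈ Submodule.span k (b '' {l | w l < w i + w j})) (f : 𝔥 →ₗ⁅k⁆ B)
    (i j : I) : f (b i) * f (b j) - f (b j) * f (b i) ∈ weightLT k (f ∘ b) w (w i + w j) := by
  rw [← Ring.lie_def, ← LieHom.map_lie]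
  have : Submodule.span k (b '' {l | w l < w i + w j}) ≤
      (weightLT k (f ∘ b) w (w i + w j)).comap (f : 𝔥 →ₗ[k] B) := by
    refine Submodule.span_le.2 ?_
    rintro _ ⟨l, hl, rfl⟩
    exact weightLT_mono (by exact_mod_cast hl) (gen_mem_weightLT (e := f ∘ b) l)
  exact this (hb i j)

/-- By the universal property, `ι` corestricted to the generated subalgebra extends to `U(𝔥)`;
followed by the inclusion it is the identity, so the subalgebra is everything. -/
theorem adjoin_range_ι_comp {b : I → 𝔥} (hb : Submodule.span k (Set.range b) = ⊤) :
    Algebra.adjoin k (Set.range (UniversalEnvelopingAlgebra.ι k ∘ b)) = ⊤ := by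
  set S := Algebra.adjoin k (Set.range (UniversalEnvelopingAlgebra.ι k ∘ b))
  have hmem (x : 𝔥) : UniversalEnvelopingAlgebra.ι k x ∈ S := by
    have : Submodule.span k (Set.range b) ≤ (Subalgebra.toSubmodule S).comap
        (UniversalEnvelopingAlgebra.ι k : 𝔥 →ₗ⁅k⁆ UniversalEnvelopingAlgebra k 𝔥).toLinearMap := by
      refine Submodule.span_le.2 ?_
      rintro _ ⟨i, rfl⟩
      exact Algebra.subset_adjoin ⟨i, rfl⟩
    exact this (hb ▸ Submodule.mem_top)
  let g : 𝔥 →ₗ⁅k⁆ S :=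
    { toFun := fun x ↦ ⟨UniversalEnvelopingAlgebra.ι k x, hmem x⟩
      map_add' := fun x y ↦ Subtype.ext (map_add _ x y)
      map_smul' := fun a x ↦ Subtype.ext (map_smul _ a x)
      map_lie' := fun {x y} ↦ Subtype.ext (LieHom.map_lie _ x y) }
  have h : S.val.comp (UniversalEnvelopingAlgebra.lift k g) = AlgHom.id k _ := by
    refine UniversalEnvelopingAlgebra.hom_ext k (LieHom.ext fun x ↦ ?_)
    change S.val (UniversalEnvelopingAlgebra.lift k g (UniversalEnvelopingAlgebra.ι k x)) = _
    rw [UniversalEnvelopingAlgebra.lift_ι_apply]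
    rfl
  refine eq_top_iff.2 fun u _ ↦ ?_
  have := AlgHom.congr_fun h u
  rw [← show _ = u from this]
  exact Subtype.property _

/-- Ordered monomials span `U(𝔥)` by reordering, and `hinj` makes their images independent. Only the
spanning half of PBW for `𝔥` enters. -/
theorem lift_bijective {b : I → 𝔥} {w : I → ℕ}
    (hb : ∀ i j, ⁅b i, b j⁆ ∈ Submodule.span k (b '' {l | w l < w i + w j}))
    (hspan : Submodule.span k (Set.range b) = ⊤) (f : 𝔥 →ₗ⁅k⁆ B)
    (hgen : Algebra.adjoin k (Set.range (f ∘ b)) = ⊤)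
    (hinj : Function.Injective (orderedEval (k := k) (f ∘ b))) :
    Function.Bijective (UniversalEnvelopingAlgebra.lift k f) := by
  have hcomp : (UniversalEnvelopingAlgebra.lift k f) ∘ (UniversalEnvelopingAlgebra.ι k ∘ b) =
      f ∘ b := by
    funext i
    exact UniversalEnvelopingAlgebra.lift_ι_apply k f (b i)
  constructor
  · refine (injective_iff_map_eq_zero _).2 fun u hu ↦ ?_
    have hle := adjoin_le_range_orderedEval
      (commutator_mem_weightLT hb (UniversalEnvelopingAlgebra.ι k))
    have hu' : u ∈ Subalgebra.toSubmodule (Algebra.adjoin k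
        (Set.range (UniversalEnvelopingAlgebra.ι k ∘ b))) := by
      rw [adjoin_range_ι_comp hspan]; trivial
    obtain ⟨p, rfl⟩ := hle hu'
    rw [map_orderedEval, hcomp] at hu
    rw [(injective_iff_map_eq_zero _).1 hinj p hu, map_zero]
  · rw [← AlgHom.range_eq_top, ← top_le_iff, ← hgen, Algebra.adjoin_le_iff]
    rintro _ ⟨i, rfl⟩
    exact ⟨UniversalEnvelopingAlgebra.ι k (b i), UniversalEnvelopingAlgebra.lift_ι_apply k f (b i)⟩

end Enveloping

/-! ### `P₂(H)` as a module over the primitive elements -/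

section AntiCocommutative

variable {k H : Type*} [Field k] [Ring H] [HopfAlgebra k H]

theorem comul_eq (h : H) :
    Coalgebra.comul (R := k) h = h ⊗ₜ[k] 1 + 1 ⊗ₜ[k] h + delta k H h := by
  simp [delta]

theorem ker_delta : LinearMap.ker (delta k H) = (primitives k H).toSubmodule := by
  ext h
  change delta k H h = 0 ↔ Coalgebra.comul (R := k) h = _
  rw [comul_eq, add_eq_left]

/-- As `Δ` is an algebra map, `ad x` on `H` corresponds to `ad Δ(x)` on `H ⊗ H`, and the latter
takes `c ⊗ 1 + 1 ⊗ c` to the same expression in `[x, c]`. -/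
theorem delta_lie {x : H} (hx : x ∈ primitives k H) (c : H) :
    delta k H ⁅x, c⁆ = ⁅x ⊗ₜ[k] (1 : H) + (1 : H) ⊗ₜ[k] x, delta k H c⁆ := by
  have h := comul_eq (k := k) ⁅x, c⁆
  rw [Ring.lie_def, map_sub, Bialgebra.comul_mul, Bialgebra.comul_mul, mem_primitives.1 hx,
    comul_eq c] at h
  rw [← sub_eq_iff_eq_add'] at h
  rw [Ring.lie_def x c, ← h, Ring.lie_def]
  simp only [mul_add, add_mul, Algebra.TensorProduct.tmul_mul_tmul, one_mul, mul_one,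
    TensorProduct.sub_tmul, TensorProduct.tmul_sub]
  abel

theorem lie_mem_range_mapIncl {x : H} (hx : x ∈ primitives k H) {t : H ⊗[k] H}
    (ht : t ∈ LinearMap.range
      (TensorProduct.mapIncl (primitives k H).toSubmodule (primitives k H).toSubmodule)) :
    ⁅x ⊗ₜ[k] (1 : H) + (1 : H) ⊗ₜ[k] x, t⁆ ∈ LinearMap.range
      (TensorProduct.mapIncl (primitives k H).toSubmodule (primitives k H).toSubmodule) := by
  obtain ⟨s, rfl⟩ := ht
  induction s with
  | zero => simp
  | add s s' h h' => rw [map_add, lie_add]; exact add_mem h h'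
  | tmul p q =>
    have h1 : x * p - p * x ∈ primitives k H := (primitives k H).lie_mem hx p.2
    have h2 : x * q - q * x ∈ primitives k H := (primitives k H).lie_mem hx q.2
    refine ⟨⟨_, h1⟩ ⊗ₜ q + p ⊗ₜ ⟨_, h2⟩, ?_⟩
    simp only [map_add, TensorProduct.mapIncl, TensorProduct.map_tmul, Submodule.subtype_apply,
      Ring.lie_def, mul_add, add_mul, Algebra.TensorProduct.tmul_mul_tmul, one_mul, mul_one,
      TensorProduct.sub_tmul, TensorProduct.tmul_sub]
    abel

/-- Bracketing with `Δ(x)`, which is fixed by `τ`, preserves antisymmetric tensors. -/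
theorem lie_mem_P₂ {x c : H} (hx : x ∈ primitives k H) (hc : c ∈ P₂ k H) : ⁅x, c⁆ ∈ P₂ k H := by
  refine ⟨?_, ?_⟩
  · rw [delta_lie hx, Ring.lie_def]
    change Algebra.TensorProduct.comm k H H _ = _
    have h : Algebra.TensorProduct.comm k H H (delta k H c) = -delta k H c := hc.1
    rw [map_sub, map_mul, map_mul, h, map_add, Algebra.TensorProduct.comm_tmul,
      Algebra.TensorProduct.comm_tmul, add_comm ((1 : H) ⊗ₜ[k] x)]
    simp only [mul_neg, neg_mul]
    abel
  · rw [delta_lie hx]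
    exact lie_mem_range_mapIncl hx hc.2

/-- On `P₂(H)` the map `δ` has values in `P(H) ⊗ P(H)` and kernel inside `P(H)`, both
finite-dimensional. -/
theorem finite_P₂ [Module.Finite k (primitives k H)] : Module.Finite k (P₂ k H) := by
  refine Module.Finite.iff_fg.2 (Submodule.fg_of_fg_map_of_fg_inf_ker (delta k H) ?_ ?_)
  · have hle : (P₂ k H).map (delta k H) ≤ LinearMap.range
        (TensorProduct.mapIncl (primitives k H).toSubmodule (primitives k H).toSubmodule) := by
      rintro _ ⟨c, hc, rfl⟩
      exact hc.2
    have : Module.Finite k (primitives k H).toSubmodule := ‹_›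
    have := Submodule.finiteDimensional_of_le hle
    exact Module.Finite.iff_fg.1 this
  · have hle : P₂ k H ⊓ LinearMap.ker (delta k H) ≤ (primitives k H).toSubmodule := by
      rw [ker_delta]; exact inf_le_right
    have : Module.Finite k (primitives k H).toSubmodule := ‹_›
    have := Submodule.finiteDimensional_of_le hle
    exact Module.Finite.iff_fg.1 this

variable (k H) in
/-- `P₂(H)` as a module over the Lie algebra of primitive elements. -/
def P₂LieSubmodule : LieSubmodule k (primitives k H) H where
  __ := P₂ k H
  lie_mem {x _} hc := lie_mem_P₂ x.2 hc

/-- Lie's theorem for the action of the primitive elements on `P₂(H) / P(H)`. -/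
theorem exists_eigenvector [IsAlgClosed k] [CharZero k] [Module.Finite k (primitives k H)]
    [LieAlgebra.IsSolvable (primitives k H)] (hne : ¬ P₂ k H ≤ (primitives k H).toSubmodule) :
    ∃ c ∈ P₂ k H, c ∉ primitives k H ∧
      ∃ χ : Module.Dual k (primitives k H), ∀ x : primitives k H,
        ⁅(x : H), c⁆ - χ x • c ∈ primitives k H := by
  let N := P₂LieSubmodule k H
  let N' : LieSubmodule k (primitives k H) N :=
    LieSubmodule.comap N.incl (primitives k H).toLieSubmodule
  have : Module.Finite k N := finite_P₂ (k := k) (H := H)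
  have hN' (c : N) : c ∈ N' ↔ (c : H) ∈ primitives k H := Iff.rfl
  have : Nontrivial (N ⧸ N') := by
    obtain ⟨c, hc, hc'⟩ := SetLike.not_le_iff_exists.1 hne
    refine ⟨LieSubmodule.Quotient.mk (⟨c, hc⟩ : N), 0, fun h ↦ hc' ?_⟩
    exact (hN' _).1 ((LieSubmodule.Quotient.mk_eq_zero').1 h)
  have : Module.Finite k (N ⧸ N') := Module.Finite.quotient k N'.toSubmodule
  obtain ⟨χ, hχ⟩ := LieModule.exists_nontrivial_weightSpace_of_isSolvable k (primitives k H)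
    (N ⧸ N')
  obtain ⟨⟨v, hv⟩, hv0⟩ := exists_ne (0 : LieModule.weightSpace (N ⧸ N') χ)
  obtain ⟨c, rfl⟩ := LieSubmodule.Quotient.surjective_mk' N' v
  refine ⟨c, c.2, fun hc ↦ hv0 (Subtype.ext ?_), χ, fun x ↦ ?_⟩
  · exact (LieSubmodule.Quotient.mk_eq_zero').2 ((hN' c).2 hc)
  · have h := (LieModule.mem_weightSpace _ _).1 hv x
    rw [← LieModuleHom.map_lie, ← map_smul, ← sub_eq_zero, ← map_sub] at h
    exact (hN' _).1 ((LieSubmodule.Quotient.mk_eq_zero').1 h)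

end AntiCocommutative

/-! ### Adjoining one eigenvector to the primitive elements -/

section Extension

variable {k H : Type*} [Field k] [Ring H] [HopfAlgebra k H] {n : ℕ}
  (b : Module.Basis (Fin n) k (primitives k H)) {c : H}

/-- A basis of the primitive elements, together with one more element. -/
def extendedFamily (b : Module.Basis (Fin n) k (primitives k H)) (c : H) : Option (Fin n) → H
  | none => c
  | some i => b i

theorem span_range_some :
    Submodule.span k (Set.range fun i ↦ extendedFamily b c (some i)) =
      (primitives k H).toSubmodule := by
  have h : (fun i ↦ extendedFamily b c (some i)) = (primitives k H).toSubmodule.subtype ∘ b := rfl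
  rw [h, Set.range_comp, ← Submodule.map_span, b.span_eq, Submodule.map_top,
    Submodule.range_subtype]

theorem linearIndependent_some : LinearIndependent k fun i ↦ extendedFamily b c (some i) :=
  b.linearIndependent.map' (primitives k H).toSubmodule.subtype (Submodule.ker_subtype _)

theorem linearIndependent_extendedFamily (hc : c ∉ primitives k H) :
    LinearIndependent k (extendedFamily b c) := by
  rw [linearIndependent_option]
  refine ⟨linearIndependent_some b, ?_⟩
  change c ∉ Submodule.span k (Set.range fun i ↦ extendedFamily b c (some i))
  rwa [span_range_some]

/-- Brackets of primitives are primitive, of weight 1 < 2. The eigenvector condition puts `[x, c]`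
in `kc + P(H)`, of weight at most 2 < 3. -/
theorem lie_extendedFamily_mem {χ : Module.Dual k (primitives k H)}
    (hχ : ∀ x : primitives k H, ⁅(x : H), c⁆ - χ x • c ∈ primitives k H)
    (i j : Option (Fin n)) : ⁅extendedFamily b c i, extendedFamily b c j⁆ ∈
      Submodule.span k (extendedFamily b c ''
        {l | optionWeight l < optionWeight i + optionWeight j}) := by
  have hP (m : ℕ) (hm : 1 < m) {x : H} (hx : x ∈ primitives k H) :
      x ∈ Submodule.span k (extendedFamily b c '' {l | optionWeight l < m}) := by
    have hx' : x ∈ Submodule.span k (Set.range fun i ↦ extendedFamily b c (some i)) := by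
      rwa [span_range_some]
    refine Submodule.span_mono ?_ hx'
    rintro _ ⟨i, rfl⟩
    exact ⟨some i, hm, rfl⟩
  have hx (i : Fin n) : ⁅(b i : H), c⁆ ∈
      Submodule.span k (extendedFamily b c '' {l | optionWeight l < 3}) := by
    rw [← sub_add_cancel ⁅(b i : H), c⁆ (χ (b i) • c)]
    refine add_mem (hP 3 (by norm_num) (hχ (b i))) (Submodule.smul_mem _ _ ?_)
    exact Submodule.subset_span ⟨none, by simp [optionWeight], rfl⟩
  rcases i with _ | i <;> rcases j with _ | j
  · rw [lie_self]; exact zero_mem _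
  · rw [← lie_skew]; exact neg_mem (hx j)
  · exact hx i
  · exact hP 2 (by norm_num) ((primitives k H).lie_mem (b i).2 (b j).2)

/-- The Lie subalgebra spanned by a family that is closed under brackets. -/
def lieSubalgebraOfSpan {I : Type*} (e : I → H)
    (he : ∀ i j, ⁅e i, e j⁆ ∈ Submodule.span k (Set.range e)) : LieSubalgebra k H where
  __ := Submodule.span k (Set.range e)
  lie_mem' {x y} hx hy := by
    change x ∈ Submodule.span k (Set.range e) at hx
    change y ∈ Submodule.span k (Set.range e) at hy
    change ⁅x, y⁆ ∈ Submodule.span k (Set.range e)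
    induction hx, hy using Submodule.span_induction₂ with
    | mem_mem x y hx hy =>
      obtain ⟨i, rfl⟩ := hx
      obtain ⟨j, rfl⟩ := hy
      exact he i j
    | zero_left => rw [zero_lie]; exact zero_mem _
    | zero_right => rw [lie_zero]; exact zero_mem _
    | add_left x y z _ _ _ h h' => rw [add_lie]; exact add_mem h h'
    | add_right x y z _ _ _ h h' => rw [lie_add]; exact add_mem h h'
    | smul_left r x y _ _ h => rw [smul_lie]; exact Submodule.smul_mem _ _ h
    | smul_right r x y _ _ h => rw [lie_smul]; exact Submodule.smul_mem _ _ h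

theorem exists_delta_eq_sum (hc : c ∈ P₂ k H) : ∃ ω : Fin n → Fin n → k,
    delta k H c = ∑ i, ∑ j, ω i j •
      (extendedFamily b c (some i) ⊗ₜ[k] extendedFamily b c (some j)) := by
  obtain ⟨t, ht⟩ := hc.2
  let bb : Module.Basis (Fin n × Fin n) k
    ((primitives k H).toSubmodule ⊗[k] (primitives k H).toSubmodule) := b.tensorProduct b
  refine ⟨fun i j ↦ bb.repr t (i, j), ?_⟩
  rw [← ht]
  conv_lhs => rw [← bb.sum_repr t]
  rw [map_sum, Fintype.sum_prod_type]
  refine Finset.sum_congr rfl fun i _ ↦ Finset.sum_congr rfl fun j _ ↦ ?_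
  rw [map_smul]
  congr 1
  have : bb (i, j) = b i ⊗ₜ b j := Module.Basis.tensorProduct_apply b b i j
  rw [this]
  rfl

/-- The two algebra maps are `Δ` and `τ ∘ Δ`: antisymmetry of `δ(c)` turns `ω` into `-ω`, and `ω ≠
0` because `c` is not primitive. -/
theorem orderedEval_extendedFamily_injective [CharZero k] (hc : c ∈ P₂ k H)
    (hcP : c ∉ primitives k H)
    (hcomm : ∀ i j, extendedFamily b c i * extendedFamily b c j -
      extendedFamily b c j * extendedFamily b c i ∈
        weightLT k (extendedFamily b c) optionWeight (optionWeight i + optionWeight j)) :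
    Function.Injective (orderedEval (k := k) (extendedFamily b c)) := by
  have := nontrivial_of_hopfAlgebra k H
  obtain ⟨ω, hω⟩ := exists_delta_eq_sum b hc
  have hx (j : Fin n) := mem_primitives.1 (b j).2
  refine orderedEval_injective (T := Bialgebra.comulAlgHom k H)
    (T' := (Algebra.TensorProduct.comm k H H).toAlgHom.comp (Bialgebra.comulAlgHom k H)) (ω := ω)
    hcomm hx ?_ ?_ ?_ (linearIndependent_some b) ?_
  · rw [← hω]
    exact comul_eq c
  · intro j
    change Algebra.TensorProduct.comm k H H (Coalgebra.comul (R := k) (b j : H)) = _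
    rw [hx j, map_add, add_comm]
    rfl
  · have h : ∑ i, ∑ j, (-ω) i j •
        (extendedFamily b c (some i) ⊗ₜ[k] extendedFamily b c (some j)) = -delta k H c := by
      rw [hω]
      simp
    rw [h, ← hc.1]
    change Algebra.TensorProduct.comm k H H (Coalgebra.comul (R := k) c) = _
    rw [comul_eq, map_add, map_add, add_comm (Algebra.TensorProduct.comm k H H (c ⊗ₜ[k] 1))]
    rfl
  · rintro rfl
    refine hcP ?_
    have : c ∈ (primitives k H).toSubmodule := by
      rw [← ker_delta, LinearMap.mem_ker, hω]
      simp
    exact this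

theorem antipode_of_mem_primitives {x : H} (hx : x ∈ primitives k H) :
    HopfAlgebra.antipode k x = -x := by
  have h := HopfAlgebra.mul_antipode_rTensor_comul_apply (R := k) x
  rw [mem_primitives.1 hx, counit_of_mem_primitives hx, map_zero] at h
  simp only [map_add, LinearMap.rTensor_tmul, LinearMap.mul'_apply, mul_one,
    HopfAlgebra.antipode_one, one_mul] at h
  exact eq_neg_of_add_eq_zero_left h

/-- The Hopf subalgebra generated by the primitive elements and an element of `P₂(H)`. -/
def extendedHopf (hc : c ∈ P₂ k H) : HopfSubalgebra k H :=
  hopfAdjoin (Set.range (extendedFamily b c))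
    (by
      have hmem (i) : extendedFamily b c i ∈
          Algebra.adjoin k (Set.range (extendedFamily b c)) := Algebra.subset_adjoin ⟨i, rfl⟩
      have htmul {x y : H} (hx : x ∈ Algebra.adjoin k (Set.range (extendedFamily b c)))
          (hy : y ∈ Algebra.adjoin k (Set.range (extendedFamily b c))) :
          x ⊗ₜ[k] y ∈ (Algebra.TensorProduct.map
            (Algebra.adjoin k (Set.range (extendedFamily b c))).val
            (Algebra.adjoin k (Set.range (extendedFamily b c))).val).range :=
        ⟨⟨x, hx⟩ ⊗ₜ ⟨y, hy⟩, rfl⟩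
      rintro _ ⟨i, rfl⟩
      rw [comul_eq]
      refine add_mem (add_mem (htmul (hmem i) (one_mem _)) (htmul (one_mem _) (hmem i))) ?_
      rcases i with _ | i
      · obtain ⟨ω, hω⟩ := exists_delta_eq_sum b hc
        change delta k H c ∈ _
        rw [hω]
        exact sum_mem fun i _ ↦ sum_mem fun j _ ↦ Subalgebra.smul_mem _ (htmul (hmem _) (hmem _)) _
      · have : delta k H (b i) = 0 := by
          rw [← LinearMap.mem_ker, ker_delta]
          exact (b i).2
        change delta k H (b i) ∈ _
        rw [this]
        exact zero_mem _)
    (by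
      have hmem (i) : extendedFamily b c i ∈
          Algebra.adjoin k (Set.range (extendedFamily b c)) := Algebra.subset_adjoin ⟨i, rfl⟩
      have hS (i : Fin n) : HopfAlgebra.antipode k (extendedFamily b c (some i)) ∈
          Algebra.adjoin k (Set.range (extendedFamily b c)) := by
        rw [show extendedFamily b c (some i) = b i from rfl, antipode_of_mem_primitives (b i).2]
        exact neg_mem (hmem (some i))
      rintro _ ⟨_ | i, rfl⟩
      · change HopfAlgebra.antipode k c ∈ _
        obtain ⟨ω, hω⟩ := exists_delta_eq_sum b hc
        -- The antipode axiom reads `S(c) + c + Σ ω_ij S(x_i) x_j = ε(c)`, which is solved for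
        -- `S(c)`.
        have h := HopfAlgebra.mul_antipode_rTensor_comul_apply (R := k) c
        rw [comul_eq, hω] at h
        simp only [map_add, map_sum, map_smul, LinearMap.rTensor_tmul, LinearMap.mul'_apply,
          mul_one, HopfAlgebra.antipode_one, one_mul] at h
        rw [add_assoc, ← eq_sub_iff_add_eq] at h
        rw [h]
        refine sub_mem (Subalgebra.algebraMap_mem _ _) (add_mem (hmem none) ?_)
        exact sum_mem fun i _ ↦ sum_mem fun j _ ↦
          Subalgebra.smul_mem _ (mul_mem (hS i) (hmem _)) _
      · exact hS i)

include b in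
theorem exists_thick_of_eigenvector [CharZero k] (hc : c ∈ P₂ k H) (hcP : c ∉ primitives k H)
    {χ : Module.Dual k (primitives k H)}
    (hχ : ∀ x : primitives k H, ⁅(x : H), c⁆ - χ x • c ∈ primitives k H)
    (hconn : IsConnectedHopf k H) :
    ∃ A : HopfSubalgebra k H, primitiveHopf k H ≤ A.toSubalgebra ∧
      IsPrimitivelyThick k A.toSubalgebra ∧
      ∃ 𝔥 : LieSubalgebra k H, Module.Finite k 𝔥 ∧ Module.finrank k 𝔥 = n + 1 ∧
        Nonempty (A.toSubalgebra ≃ₐ[k] UniversalEnvelopingAlgebra k 𝔥) := by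
  set e := extendedFamily b c
  have hlie := lie_extendedFamily_mem b hχ
  let 𝔥 : LieSubalgebra k H := lieSubalgebraOfSpan e fun i j ↦
    Submodule.span_mono (Set.image_subset_range _ _) (hlie i j)
  let A := extendedHopf b hc
  have h𝔥A {x : H} (hx : x ∈ 𝔥) : x ∈ A.toSubalgebra := Algebra.span_le_adjoin _ _ hx
  have hP : (primitives k H : Set H) ⊆ A.toSubalgebra := by
    intro x hx
    have hx' : x ∈ Submodule.span k (Set.range fun i ↦ e (some i)) := by
      rwa [span_range_some]
    refine h𝔥A (Submodule.span_mono ?_ hx')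
    rintro _ ⟨i, rfl⟩
    exact ⟨some i, rfl⟩
  let B : Module.Basis (Option (Fin n)) k 𝔥 :=
    Module.Basis.span (linearIndependent_extendedFamily b hcP)
  have hB (i) : (B i : H) = e i :=
    congrArg Subtype.val (Module.Basis.span_apply (linearIndependent_extendedFamily b hcP) i)
  have hBlie (i j) : ⁅B i, B j⁆ ∈
      Submodule.span k (B '' {l | optionWeight l < optionWeight i + optionWeight j}) := by
    have h := hlie i j
    have himg : e '' {l | optionWeight l < optionWeight i + optionWeight j} =
        𝔥.toSubmodule.subtype '' (B '' {l | optionWeight l < optionWeight i + optionWeight j}) := by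
      rw [Set.image_image]
      exact Set.image_congr fun l _ ↦ (hB l).symm
    rw [himg, ← Submodule.map_span] at h
    obtain ⟨y, hy, hy'⟩ := h
    have : y = ⁅B i, B j⁆ := by
      refine Subtype.ext (hy'.trans ?_)
      rw [LieSubalgebra.coe_bracket, hB, hB]
    rwa [← this]
  let f : 𝔥 →ₗ⁅k⁆ A.toSubalgebra :=
    { toFun := fun x ↦ ⟨x, h𝔥A x.2⟩
      map_add' := fun _ _ ↦ rfl
      map_smul' := fun _ _ ↦ rfl
      map_lie' := rfl }
  have hval : A.toSubalgebra.val ∘ (f ∘ B) = e := funext hB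
  have hval' : 𝔥.incl ∘ B = e := funext hB
  have hcommH := commutator_mem_weightLT hBlie 𝔥.incl
  have hcommA := commutator_mem_weightLT hBlie f
  have hinjH : Function.Injective (orderedEval (k := k) e) := by
    refine orderedEval_extendedFamily_injective b hc hcP fun i j ↦ ?_
    have := hcommH i j
    rwa [hval', show 𝔥.incl (B i) = e i from hB i, show 𝔥.incl (B j) = e j from hB j] at this
  -- Evaluation in `H` factors through evaluation in `A`, so injectivity passes to `A`.
  have hinj : Function.Injective (orderedEval (k := k) (f ∘ B)) := by
    rw [← hval] at hinjH
    refine Function.Injective.of_comp (f := A.toSubalgebra.val) ?_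
    convert hinjH using 1
    exact funext fun p ↦ map_orderedEval _ _ p
  have hgen : Algebra.adjoin k (Set.range (f ∘ B)) = ⊤ := by
    have := Algebra.adjoin_adjoin_coe_preimage (R := k) (s := Set.range e)
    refine top_le_iff.1 (this.ge.trans (Algebra.adjoin_mono ?_))
    rintro ⟨x, hx⟩ ⟨i, hi⟩
    exact ⟨i, Subtype.ext ((hB i).trans hi)⟩
  -- All primitives of `H` lie in `A`, so `A` has `n` independent primitives but `n + 1` generators;
  -- this difference is primitive thickness.
  have hfr : Module.finrank k (primitives k A.toSubalgebra) = n := by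
    rw [(A.primitivesEquiv hP).finrank_eq, Module.finrank_eq_card_basis b, Fintype.card_fin]
  refine ⟨A, primitiveHopf_le A hP, ⟨A.isConnectedHopf hconn, ?_, ?_⟩, 𝔥,
    Module.Finite.of_basis B, ?_, ?_⟩
  · have := Module.Finite.of_basis b
    exact Module.Finite.equiv (A.primitivesEquiv hP).symm
  · rw [hfr]
    have hcard : Fintype.card (Option (Fin n)) = n + 1 := by simp
    rw [← hcard]
    refine le_antisymm (gkDim_le_card hcommA (fun i ↦ ?_) hgen) (card_le_gkDim hinj)
    rcases i with _ | i <;> simp [optionWeight]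
  · rw [Module.finrank_eq_card_basis B, Fintype.card_option, Fintype.card_fin]
  · exact ⟨(AlgEquiv.ofBijective _ (lift_bijective hBlie B.span_eq f hgen hinj)).symm⟩

end Extension

/-! ### Conclusion for the class `𝒜(𝔤)` -/

theorem hopfClosure_mono {k H : Type*} [Field k] [Ring H] [HopfAlgebra k H] {s t : Set H}
    (h : s ⊆ t) : hopfClosure k s ≤ hopfClosure k t :=
  sInf_le_sInf fun _ ⟨A, hA, ht⟩ ↦ ⟨A, hA, h.trans ht⟩

theorem exists_thick_of_memClassA {k : Type u} {H : Type v} {𝔤 : Type w} [Field k] [IsAlgClosed k] [CharZero k]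
    [Ring H] [HopfAlgebra k H] [LieRing 𝔤] [LieAlgebra k 𝔤] [LieAlgebra.IsSolvable 𝔤]
    (hH : MemClassA k H 𝔤) :
    ∃ A : HopfSubalgebra k H,
      primitiveHopf k H ≤ A.toSubalgebra ∧
      IsPrimitivelyThick k A.toSubalgebra ∧
      ∃ (𝔥 : Type v) (_ : LieRing 𝔥) (_ : LieAlgebra k 𝔥),
        Module.Finite k 𝔥 ∧ Module.finrank k 𝔥 = Module.finrank k 𝔤 + 1 ∧
        Nonempty (A.toSubalgebra ≃ₐ[k] UniversalEnvelopingAlgebra k 𝔥) := by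
  obtain ⟨φ⟩ := hH.primitives_equiv
  have := hH.finite
  have hfin : Module.Finite k (primitives k H) := Module.Finite.equiv φ.toLinearEquiv
  have hsolv : LieAlgebra.IsSolvable (primitives k H) :=
    φ.symm.injective.lieAlgebra_isSolvable
  -- If `P₂(H)` contained only primitives, the Hopf algebra it generates, namely `H`, would be
  -- `U_H`.
  have hne : ¬ P₂ k H ≤ (primitives k H).toSubmodule := fun hle ↦
    hH.ne_primitiveHopf (top_le_iff.1 (hH.generated.ge.trans (hopfClosure_mono hle)))
  obtain ⟨c, hc, hcP, χ, hχ⟩ := exists_eigenvector hne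
  obtain ⟨A, hUA, hA, 𝔥, hfin', hrank, hiso⟩ := exists_thick_of_eigenvector
    (Module.finBasis k (primitives k H)) hc hcP hχ hH.connected
  exact ⟨A, hUA, hA, 𝔥, inferInstance, inferInstance, hfin',
    by rw [hrank, φ.toLinearEquiv.finrank_eq], hiso⟩

end ConnHopf
end

theorem lemma3p3 {k : Type u} {H : Type v} {𝔤 : Type w} [Field k] [IsAlgClosed k] [CharZero k]
    [Ring H] [HopfAlgebra k H] [LieRing 𝔤] [LieAlgebra k 𝔤] [LieAlgebra.IsSolvable 𝔤]
    (hH : ConnHopf.MemClassA k H 𝔤) :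
    ∃ A : ConnHopf.HopfSubalgebra k H,
      ConnHopf.primitiveHopf k H ≤ A.toSubalgebra ∧
      ConnHopf.IsPrimitivelyThick k A.toSubalgebra ∧
      ∃ (𝔥 : Type v) (_ : LieRing 𝔥) (_ : LieAlgebra k 𝔥),
        Module.Finite k 𝔥 ∧ Module.finrank k 𝔥 = Module.finrank k 𝔤 + 1 ∧
        Nonempty (A.toSubalgebra ≃ₐ[k] UniversalEnvelopingAlgebra k 𝔥) := by
  exact ConnHopf.exists_thick_of_memClassA hH
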